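/- **Theorem (Decidability of symmetric LCS-games).** Let $Q$, $\mathsf{C}$, $\mathsf{M}$ be finite sets of locations, channels and messages. A configuration is a pair $\sigma=(q,w)$ with $q\in Q$ and $w:\mathsf{C}\to\mathsf{M}^*$; $(q,w)\sqsubseteq(q',w')$ means that $q=q'$ and that $w(c)$ is a subword of $w'(c)$ for every channel $c$. A (regular) region is a finite union of sets $\{q\}\times\prod_{c\in\mathsf{C}}R^c$ with every $R^c\subseteq\mathsf{M}^*$ a regular language. A generalized lossy channel system (GLCS) has a finite set of rules $p\xrightarrow{G:op}q$, where the guard $G$ is a region and $op$ is a send $c!m$ (append $m$ to channel $c$), a receive $c?m$ (remove $m$ from the head of channel $c$) or an internal action. A step $\sigma\to\rho$ consists in choosing a rule $p\xrightarrow{G:op}q$ with $\sigma\in G$ that can be fired in $\sigma$, firing it, which gives $\sigma'$, and then choosing some $\rho\sqsubseteq\sigma'$. A symmetric LCS-game $\mathcal{L}$ is a GLCS with a partition $Q=Q_A\cup Q_B$ such that every rule $p\xrightarrow{G:op}q$ satisfies $p\in Q_A\iff q\in Q_B$. Players $A$ and $B$ move in turn: the owner of the current location picks the step, i.e. both the rule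 and the message losses. Plays are maximal sequences of steps, and strategies may depend on the history. The goals $\Diamond V$, $\Box V$, $\Diamond\Box V$, $\Box\Diamond V$ ask for a visit to $V$, for staying in $V$ forever, for staying in $V$ from some moment on, and for infinitely many visits to $V$, respectively. If deadlocks occur, the player who is to move in one loses, except that $\Diamond V$ is definitively won once $V$ has been visited and $\Box V$ is definitively lost once $V$ has been left. For a goal $\varphi$, $\langle\!\langle A\rangle\!\rangle\varphi$ is the set of configurations from which $A$ has a strategy that wins against all behaviours of $B$. Then for every symmetric LCS-game $\mathcal{L}$ and every region $V$, the four winning sets $$\langle\!\langle A\rangle\!\rangle\Diamond V,\qquad \langle\!\langle A\rangle\!\rangle\Box V,\qquad \langle\!\langle A\rangle\!\rangle\Diamond\Box V,\qquad \langle\!\langle A\rangle\!\rangle\Box\Diamond V$$ are regions, and they are effective: for each of the four goals there is an algorithm that computes, from $\mathcal{L}$ and $V$ (guards and $V$ being given by finite automata), a representation of the winning set by finite automata. Hence reachability, invariant, persistence and repeated reachability games are decidable: for each of the four goals there is an algorithm that decides, given $\mathcal{L}$, $V$ and a configuration $\sigma$, whether $A$ has a winning strategy from $\sigma$. -/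

import Mathlib

/-!
Generalized lossy channel systems, symmetric two-player games on them, and finite codes of
games, regions and configurations as inputs and outputs of algorithms.
-/

namespace LCS

/-! ### Configurations and regions -/

/-- A configuration `(q, w)`: a location and the contents of all channels. -/
abbrev Conf (Q C M : Type*) := Q × (C → List M)

/-- The subword ordering on configurations: same location, and each channel content is obtained
by erasing letters. -/
def Conf.Sub {Q C M : Type*} (ρ σ : Conf Q C M) : Prop :=
  ρ.1 = σ.1 ∧ ∀ c, (ρ.2 c).Sublist (σ.2 c)

/-- Regular regions: finite unions of products `(q i, R i c₁, …, R i cₖ)` of a location and one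
regular language per channel. -/
def IsRegion {Q C M : Type*} (V : Set (Conf Q C M)) : Prop :=
  ∃ (n : ℕ) (q : Fin n → Q) (R : Fin n → C → Language M),
    (∀ i c, (R i c).IsRegular) ∧
      V = {σ | ∃ i, σ.1 = q i ∧ ∀ c, σ.2 c ∈ R i c}

/-! ### Lossy channel systems with regular guards -/

/-- Operations: send `c!m`, receive `c?m`, and the internal action. -/
inductive Op (C M : Type*)
  | send (c : C) (m : M)
  | recv (c : C) (m : M)
  | internal

/-- `op.Effect w w'`: the operation `op` can be performed on the channel contents `w` and turns
them into `w'`. Messages are written at the end and read at the beginning of a channel. -/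
def Op.Effect {C M : Type*} : Op C M → (C → List M) → (C → List M) → Prop
  | .send c m, w, w' => w' c = w c ++ [m] ∧ ∀ d, d ≠ c → w' d = w d
  | .recv c m, w, w' => w c = m :: w' c ∧ ∀ d, d ≠ c → w' d = w d
  | .internal, w, w' => w' = w

/-- A guarded rule `src --guard : op--> tgt`. -/
structure Rule (Q C M : Type*) where
  src : Q
  guard : Set (Conf Q C M)
  op : Op C M
  tgt : Q

/-- The perfect (lossless) step by a guarded rule. -/
def Rule.PerfStep {Q C M : Type*} (δ : Rule Q C M) (σ σ' : Conf Q C M) : Prop :=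
  σ ∈ δ.guard ∧ σ.1 = δ.src ∧ σ'.1 = δ.tgt ∧ δ.op.Effect σ.2 σ'.2

/-- The lossy step by a guarded rule: a perfect step followed by arbitrary message losses. -/
def Rule.Step {Q C M : Type*} (δ : Rule Q C M) (σ ρ : Conf Q C M) : Prop :=
  ∃ σ', δ.PerfStep σ σ' ∧ ρ.Sub σ'

/-- A lossy channel system with regular guards. The sets `Q`, `C`, `M` of locations, channels and
messages are assumed to be finite wherever this structure is used. -/
structure GLCS (Q C M : Type*) where
  rules : Set (Rule Q C M)
  finite_rules : rules.Finite
  guard_isRegion : ∀ δ ∈ rules, IsRegion δ.guard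

/-- One-step successor relation between configurations. -/
def GLCS.Step {Q C M : Type*} (L : GLCS Q C M) (σ ρ : Conf Q C M) : Prop :=
  ∃ δ ∈ L.rules, δ.Step σ ρ

/-! ### Symmetric games -/

/-- The two players. -/
inductive Player
  | A
  | B

/-- The other player. -/
def Player.opponent : Player → Player
  | .A => .B
  | .B => .A

/-- A symmetric LCS-game: the locations are partitioned among the players, and the rules ensure
strict alternation. -/
structure SymGame (Q C M : Type*) extends GLCS Q C M where
  owner : Q → Player
  alternating : ∀ δ ∈ rules, owner δ.src = Player.A ↔ owner δ.tgt = Player.B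

namespace SymGame

variable {Q C M : Type*}

/-- `σ` is a deadlock: no move is possible. -/
def Deadlock (L : SymGame Q C M) (σ : Conf Q C M) : Prop :=
  ¬ ∃ ρ, L.Step σ ρ

/-- A (history-dependent) strategy of player `P`. It is given the list of the earlier
configurations and the current configuration, and picks the next configuration, that is, both the
rule and the messages that are lost. It has to pick a legal move whenever `P` is to move and can
move. -/
structure Strategy (L : SymGame Q C M) (P : Player) where
  next : List (Conf Q C M) → Conf Q C M → Conf Q C M
  legal : ∀ h σ, L.owner σ.1 = P → ¬ L.Deadlock σ → L.Step σ (next h σ)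

/-- A play: a maximal sequence of moves. It is infinite if `len = ⊤`; if `len = n`, it consists of
`state 0, …, state n` only, and `state n` is a deadlock. -/
structure Play (L : SymGame Q C M) where
  len : ℕ∞
  state : ℕ → Conf Q C M
  step : ∀ i : ℕ, (i : ℕ∞) < len → L.Step (state i) (state (i + 1))
  maximal : ∀ n : ℕ, len = n → L.Deadlock (state n)

/-- All moves of player `P` in the play `π` are made according to the strategy `f`. -/
def Play.Follows {L : SymGame Q C M} {P : Player} (π : L.Play) (f : L.Strategy P) : Prop :=
  ∀ i : ℕ, (i : ℕ∞) < π.len → L.owner (π.state i).1 = P →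
    π.state (i + 1) = f.next ((List.range i).map π.state) (π.state i)

/-- The play `π` ends in a deadlock in which it is the turn of player `P`. -/
def Play.Stuck {L : SymGame Q C M} (π : L.Play) (P : Player) : Prop :=
  ∃ n : ℕ, π.len = n ∧ L.owner (π.state n).1 = P

end SymGame

/-- The goals `◇V`, `□V`, `◇□V` and `□◇V`. -/
inductive Goal
  | reachability
  | invariant
  | persistence
  | repeatedReachability

namespace SymGame

variable {Q C M : Type*}

/-- Player `P`, who pursues the goal relative to `V`, wins the play `π`. On an infinite play this
is the usual meaning of the goal. A player who is to move and cannot loses, except that a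
reachability goal (an invariant goal) is definitively won (lost) once `V` is reached (left). -/
def Play.WonBy {L : SymGame Q C M} (π : L.Play) (P : Player) (V : Set (Conf Q C M)) : Goal → Prop
  | .reachability =>
      (∃ i : ℕ, (i : ℕ∞) ≤ π.len ∧ π.state i ∈ V) ∨ π.Stuck P.opponent
  | .invariant =>
      (∀ i : ℕ, (i : ℕ∞) ≤ π.len → π.state i ∈ V) ∧ ¬ π.Stuck P
  | .persistence =>
      (π.len = ⊤ ∧ ∃ n : ℕ, ∀ i, n ≤ i → π.state i ∈ V) ∨ π.Stuck P.opponent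
  | .repeatedReachability =>
      (π.len = ⊤ ∧ ∀ n : ℕ, ∃ i, n ≤ i ∧ π.state i ∈ V) ∨ π.Stuck P.opponent

/-- The winning set `⟨⟨P⟩⟩ goal V`: the configurations from which `P` has a winning strategy. -/
def winningSet (L : SymGame Q C M) (P : Player) (goal : Goal) (V : Set (Conf Q C M)) :
    Set (Conf Q C M) :=
  {σ | ∃ f : L.Strategy P, ∀ π : L.Play, π.state 0 = σ → π.Follows f → π.WonBy P V goal}

end SymGame

/-! ### Codes

All codes are built from natural numbers by products and lists, so that Mathlib's notion of a
computable function applies to them. -/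

/-- A numbering of the locations, channels and messages by `0, 1, 2, …`. -/
structure Numbering (Q C M : Type*) where
  nQ : ℕ
  nC : ℕ
  nM : ℕ
  loc : Q ≃ Fin nQ
  chan : C ≃ Fin nC
  msg : M ≃ Fin nM

/-- A finite automaton: initial states, transitions `(s, m, t)`, accepting states. -/
abbrev AutCode := List ℕ × List (ℕ × ℕ × ℕ) × List ℕ

/-- The nondeterministic automaton that is given by a code. -/
def AutCode.toNFA (a : AutCode) : NFA ℕ ℕ where
  step s m := {t | (s, m, t) ∈ a.2.1}
  start := {s | s ∈ a.1}
  accept := {s | s ∈ a.2.2}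

/-- A region: a list of products, each of them given by a location and a list of automata, one
for each channel. -/
abbrev RegionCode := List (ℕ × List AutCode)

/-- A configuration: a location and the list of the channel contents. -/
abbrev ConfCode := ℕ × List (List ℕ)

/-- An operation: `none` is the internal action, `some (true, c, m)` is `c!m`, and
`some (false, c, m)` is `c?m`. -/
abbrev OpCode := Option (Bool × ℕ × ℕ)

/-- A rule: source, guard, operation, target. -/
abbrev RuleCode := ℕ × RegionCode × OpCode × ℕ

/-- A game: the numbers of locations, of channels and of messages, the list of the locations of
player `A`, and the list of the rules. -/
abbrev GameCode := (ℕ × ℕ × ℕ) × List ℕ × List RuleCode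

section Encodings

variable {Q C M : Type*} (num : Numbering Q C M)

/-- The set of configurations that is denoted by the code of a region. -/
def RegionCode.denote (R : RegionCode) : Set (Conf Q C M) :=
  {σ | ∃ r ∈ R, r.1 = (num.loc σ.1 : ℕ) ∧
    ∀ c : C, ∃ a : AutCode, r.2[(num.chan c : ℕ)]? = some a ∧
      (σ.2 c).map (fun m => (num.msg m : ℕ)) ∈ (AutCode.toNFA a).accepts}

/-- The code of a configuration. -/
def confCode (σ : Conf Q C M) : ConfCode :=
  (num.loc σ.1, List.ofFn fun j : Fin num.nC =>
    (σ.2 (num.chan.symm j)).map (fun m => (num.msg m : ℕ)))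

/-- The code of an operation. -/
def opCode : Op C M → OpCode
  | .send c m => some (true, num.chan c, num.msg m)
  | .recv c m => some (false, num.chan c, num.msg m)
  | .internal => none

/-- `r` is a code of the rule `δ`. -/
def RuleCode.Encodes (r : RuleCode) (δ : Rule Q C M) : Prop :=
  r.1 = (num.loc δ.src : ℕ) ∧ RegionCode.denote num r.2.1 = δ.guard ∧
    r.2.2.1 = opCode num δ.op ∧ r.2.2.2 = (num.loc δ.tgt : ℕ)

/-- `g` is a code of the game `L`. -/
def GameCode.Encodes (g : GameCode) (L : SymGame Q C M) : Prop :=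
  g.1 = (num.nQ, num.nC, num.nM) ∧
    (∀ q, (num.loc q : ℕ) ∈ g.2.1 ↔ L.owner q = Player.A) ∧
    (∀ r ∈ g.2.2, ∃ δ ∈ L.rules, RuleCode.Encodes num r δ) ∧
    (∀ δ ∈ L.rules, ∃ r ∈ g.2.2, RuleCode.Encodes num r δ)

end Encodings

/-! ### Every region and every game has a code -/

section Adequacy

variable {Q C M : Type*} (num : Numbering Q C M)

theorem exists_autCode {R : Language M} (hR : R.IsRegular) :
    ∃ a : AutCode, ∀ w : List M,
      w.map (fun m => (num.msg m : ℕ)) ∈ (AutCode.toNFA a).accepts ↔ w ∈ R := by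
  classical
  obtain ⟨S, _, D, rfl⟩ := hR
  have : Fintype M := Fintype.ofEquiv _ num.msg.symm
  let e := Fintype.equivFin S
  let a : AutCode := ([(e D.start : ℕ)],
    (Finset.univ : Finset (S × M)).toList.map
      (fun p => ((e p.1 : ℕ), (num.msg p.2 : ℕ), (e (D.step p.1 p.2) : ℕ))),
    (Finset.univ.filter (· ∈ D.accept)).toList.map (fun s => (e s : ℕ)))
  have inj : ∀ s t : S, (e s : ℕ) = e t ↔ s = t := fun s t => by
    rw [← Fin.ext_iff, e.injective.eq_iff]
  have injM : ∀ s t : M, (num.msg s : ℕ) = num.msg t ↔ s = t := fun s t => by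
    rw [← Fin.ext_iff, num.msg.injective.eq_iff]
  have hstep : ∀ (s : S) (m : M),
      (AutCode.toNFA a).stepSet {(e s : ℕ)} (num.msg m : ℕ) = {(e (D.step s m) : ℕ)} := by
    intro s m
    ext t
    simp only [NFA.stepSet, AutCode.toNFA, a, Set.mem_iUnion, Set.mem_singleton_iff,
      Set.mem_ofPred_eq, List.mem_map, Finset.mem_toList, Finset.mem_univ, true_and,
      Prod.mk.injEq, Prod.exists, exists_prop, exists_eq_left]
    constructor
    · rintro ⟨s', m', h1, h2, h3⟩
      rw [inj] at h1
      rw [injM] at h2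
      subst h1 h2
      exact h3.symm
    · rintro rfl
      exact ⟨s, m, rfl, rfl, rfl⟩
  have hrun : ∀ (w : List M) (s : S),
      (AutCode.toNFA a).evalFrom {(e s : ℕ)} (w.map (fun m => (num.msg m : ℕ)))
        = {(e (D.evalFrom s w) : ℕ)} := by
    intro w
    induction w with
    | nil => intro s; simp
    | cons m w ih =>
      intro s
      rw [List.map_cons, NFA.evalFrom_cons, hstep, ih, DFA.evalFrom_cons]
  refine ⟨a, fun w => ?_⟩
  have hstart : (AutCode.toNFA a).start = {(e D.start : ℕ)} := by
    ext t; simp [AutCode.toNFA, a]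
  rw [NFA.mem_accepts, hstart, hrun, DFA.mem_accepts]
  simp only [Set.mem_singleton_iff, exists_eq_right]
  simp [AutCode.toNFA, a, inj, DFA.eval]

theorem exists_regionCode {V : Set (Conf Q C M)} (hV : IsRegion V) :
    ∃ R : RegionCode, RegionCode.denote num R = V := by
  obtain ⟨n, q, R, hR, rfl⟩ := hV
  choose a ha using fun i c => exists_autCode num (hR i c)
  refine ⟨List.ofFn fun i : Fin n =>
    ((num.loc (q i) : ℕ), List.ofFn fun j : Fin num.nC => a i (num.chan.symm j)), ?_⟩
  ext σ
  simp only [RegionCode.denote, Set.mem_ofPred_eq, List.mem_ofFn, exists_exists_eq_and]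
  refine exists_congr fun i => and_congr ?_ (forall_congr' fun c => ?_)
  · rw [← Fin.ext_iff, num.loc.injective.eq_iff, eq_comm]
  · simp [ha]

theorem exists_gameCode (L : SymGame Q C M) : ∃ g : GameCode, GameCode.Encodes num g L := by
  classical
  have : Fintype Q := Fintype.ofEquiv _ num.loc.symm
  have h : ∀ δ ∈ L.rules, ∃ R : RegionCode, RegionCode.denote num R = δ.guard :=
    fun δ hδ => exists_regionCode num (L.guard_isRegion δ hδ)
  choose! G hG using h
  refine ⟨((num.nQ, num.nC, num.nM),
    (Finset.univ.filter (fun q => L.owner q = Player.A)).toList.map (fun q => (num.loc q : ℕ)),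
    L.finite_rules.toFinset.toList.map
      (fun δ => ((num.loc δ.src : ℕ), G δ, opCode num δ.op, (num.loc δ.tgt : ℕ)))),
    rfl, fun q => ?_, fun r hr => ?_, fun δ hδ => ?_⟩
  · simp [← Fin.ext_iff]
  · simp only [List.mem_map, Finset.mem_toList, Set.Finite.mem_toFinset] at hr
    obtain ⟨δ, hδ, rfl⟩ := hr
    exact ⟨δ, hδ, rfl, hG δ hδ, rfl, rfl⟩
  · refine ⟨_, List.mem_map.2 ⟨δ, by simpa using hδ, rfl⟩, rfl, hG δ hδ, rfl, rfl⟩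

end Adequacy

end LCS

namespace LCS

/-! ### Controllable predecessors and winning strategies -/

/-! Reachability is the least fixpoint of `X ↦ V ∪ cpre X`, and repeated reachability is the nested
fixpoint `νY μX` of `(V ∩ cpre Y) ∪ cpre X`. Invariant and persistence goals are the opponent's
duals of these two.

Both iterations stop because each player chooses the losses of their own moves, so successor sets
are closed under subwords. At a configuration of `P`, membership in `cpre P X` therefore depends
only on the upward closure of the opponent's part of `X`. At a configuration of the opponent,
membership in `cpre P Y` depends only on the upward closure of the part of `Yᶜ` that belongs to `P`.
Increasing chains of upward closed sets stabilise by Higman's lemma. The first fact settles the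
inner iteration (`exists_approx_eq`). The second settles the outer one (`exists_certifies`),
provided that `Y` is consulted only below a move of the opponent; this is why `stepOp` looks two
moves ahead at configurations of `P`.

All approximants are regions. With finitely many locations and channels, regions are exactly the
sets that are saturated, channel by channel, for a right congruence of finite index, and one
predecessor step only replaces such a congruence by the finite-index congruence `refine`
(`Respects.cpre`). No automata constructions for products, complements or predecessors are needed.

The algorithm searches for a certificate: finite sequences of regions that bound the winning set
from inside (`X`) and from outside (`Y`). Such a certificate is sound, because each side yields
winning strategies for one player (`Certifies.winningSet_eq`). One always exists, by termination of
the iterations. Its validity is decidable: whether its conditions hold at a configuration depends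
only on congruence classes, each class contains a short word (`exists_short`), and so finitely many
configurations suffice (`check_iff`). The test is primitive recursive, hence the unbounded search is
computable, and membership in the region found decides the game. -/

@[simp]
theorem Player.opponent_opponent (P : Player) : P.opponent.opponent = P := by cases P <;> rfl

theorem Player.opponent_ne (P : Player) : P.opponent ≠ P := by cases P <;> simp [opponent]

theorem Player.eq_or_eq_opponent (P p : Player) : p = P ∨ p = P.opponent := by
  cases P <;> cases p <;> simp [opponent]

namespace SymGame

variable {Q C M : Type*}

/-- The configurations from which `P` can enforce `X` in one move. -/
def cpre (L : SymGame Q C M) (P : Player) (X : Set (Conf Q C M)) : Set (Conf Q C M) :=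
  {σ | (L.owner σ.1 = P ∧ ∃ ρ, L.Step σ ρ ∧ ρ ∈ X) ∨
    (L.owner σ.1 = P.opponent ∧ ∀ ρ, L.Step σ ρ → ρ ∈ X)}

theorem cpre_mono (L : SymGame Q C M) (P : Player) {X Y : Set (Conf Q C M)} (h : X ⊆ Y) :
    L.cpre P X ⊆ L.cpre P Y := by
  rintro σ (⟨h1, ρ, h2, h3⟩ | ⟨h1, h2⟩)
  · exact .inl ⟨h1, ρ, h2, h h3⟩
  · exact .inr ⟨h1, fun ρ hρ => h (h2 ρ hρ)⟩

theorem owner_step (L : SymGame Q C M) {σ ρ : Conf Q C M} (h : L.Step σ ρ) :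
    L.owner ρ.1 = (L.owner σ.1).opponent := by
  obtain ⟨δ, hδ, σ', ⟨-, h1, h2, -⟩, h3, -⟩ := h
  have := L.alternating δ hδ
  rw [h3, h2, h1]
  cases h4 : L.owner δ.src <;> cases h5 : L.owner δ.tgt <;> simp_all [Player.opponent]

/-- All winning strategies below come from this choice and ignore the history. Where no good
successor exists, the move is only required to be legal. -/
theorem exists_positional (L : SymGame Q C M) (P : Player)
    (good : Conf Q C M → Conf Q C M → Prop) :
    ∃ f : L.Strategy P, ∀ h σ, (∃ ρ, L.Step σ ρ ∧ good σ ρ) → good σ (f.next h σ) := by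
  classical
  refine ⟨⟨fun _ σ => if h : ∃ ρ, L.Step σ ρ ∧ good σ ρ then h.choose else
    if h : ∃ ρ, L.Step σ ρ then h.choose else σ, ?_⟩, ?_⟩
  · intro _ σ _ hσ
    have hσ : ∃ ρ, L.Step σ ρ := not_not.1 hσ
    split_ifs with h
    · exact h.choose_spec.1
    · exact hσ.choose_spec
  · intro _ σ h
    simp only [h, dif_pos]
    exact h.choose_spec.2

theorem exists_play (L : SymGame Q C M) {P : Player} (f : L.Strategy P)
    (f' : L.Strategy P.opponent) (σ : Conf Q C M) :
    ∃ π : L.Play, π.state 0 = σ ∧ π.Follows f ∧ π.Follows f' := by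
  classical
  let nx (h : List (Conf Q C M)) (τ : Conf Q C M) : Conf Q C M :=
    if L.owner τ.1 = P then f.next h τ else f'.next h τ
  -- The recursion carries the history along with the current configuration, since arbitrary
  -- strategies may consult it.
  let H : ℕ → List (Conf Q C M) × Conf Q C M := fun i =>
    Nat.rec ([], σ) (fun _ p => (p.1 ++ [p.2], nx p.1 p.2)) i
  have hH : ∀ i, (H i).1 = (List.range i).map fun j => (H j).2 := by
    intro i
    induction i with
    | zero => rfl
    | succ i ih => rw [List.range_succ, List.map_append, ← ih]; rfl
  have hnx : ∀ i, (H (i + 1)).2 = nx ((List.range i).map fun j => (H j).2) (H i).2 := by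
    intro i; rw [← hH]
  have hstep : ∀ i, ¬ L.Deadlock (H i).2 → L.Step (H i).2 (H (i + 1)).2 := by
    intro i hi
    rw [hnx]
    dsimp only [nx]
    split_ifs with h
    · exact f.legal _ _ h hi
    · exact f'.legal _ _ ((P.eq_or_eq_opponent _).resolve_left h) hi
  have key : ∃ len : ℕ∞, (∀ i : ℕ, (i : ℕ∞) < len → ¬ L.Deadlock (H i).2) ∧
      ∀ n : ℕ, len = n → L.Deadlock (H n).2 := by
    by_cases h : ∃ n, L.Deadlock (H n).2
    · refine ⟨(Nat.find h : ℕ), fun i hi => Nat.find_min h (by exact_mod_cast hi), fun n hn => ?_⟩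
      have : Nat.find h = n := by exact_mod_cast hn
      rw [← this]
      exact Nat.find_spec h
    · exact ⟨⊤, fun i _ hi => h ⟨i, hi⟩, fun n hn => by simp at hn⟩
  obtain ⟨len, h1, h2⟩ := key
  refine ⟨⟨len, fun i => (H i).2, fun i hi => hstep i (h1 i hi), h2⟩, rfl, ?_, ?_⟩
  · intro i _ ho
    exact (hnx i).trans (if_pos ho)
  · intro i _ ho
    refine (hnx i).trans (if_neg fun h => P.opponent_ne ?_)
    rw [← ho, ← h]

end SymGame

/-- The goal of the opponent, relative to the complementary set. -/
def Goal.dual : Goal → Goal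
  | .reachability => .invariant
  | .invariant => .reachability
  | .persistence => .repeatedReachability
  | .repeatedReachability => .persistence

/-! ### Duality of goals and one-step use of controllable predecessors -/

namespace SymGame

variable {Q C M : Type*}

theorem Play.not_stuck_both {L : SymGame Q C M} (π : L.Play) (P : Player) (h : π.Stuck P)
    (h' : π.Stuck P.opponent) : False := by
  obtain ⟨n, hn, ho⟩ := h
  obtain ⟨m, hm, ho'⟩ := h'
  have : n = m := by rw [hn] at hm; exact_mod_cast hm
  subst this
  exact P.opponent_ne (ho'.symm.trans ho)

theorem Play.not_stuck_of_top {L : SymGame Q C M} {π : L.Play} (h : π.len = ⊤) (P : Player) :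
    ¬ π.Stuck P := by
  rintro ⟨n, hn, -⟩
  rw [h] at hn
  simp at hn

theorem Play.not_wonBy_both {L : SymGame Q C M} (π : L.Play) (P : Player) (goal : Goal)
    (V : Set (Conf Q C M)) (h : π.WonBy P V goal) (h' : π.WonBy P.opponent Vᶜ goal.dual) :
    False := by
  cases goal with
  | reachability =>
    rcases h with ⟨i, hi, hV⟩ | h
    · exact h'.1 i hi hV
    · exact h'.2 h
  | invariant =>
    rcases h' with ⟨i, hi, hV⟩ | h'
    · exact hV (h.1 i hi)
    · exact h.2 (by simpa using h')
  | persistence =>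
    rcases h with ⟨ht, n, hn⟩ | h <;> rcases h' with ⟨ht', h'⟩ | h'
    · obtain ⟨i, hi, hV⟩ := h' n
      exact hV (hn i hi)
    · exact π.not_stuck_of_top ht _ h'
    · exact π.not_stuck_of_top ht' _ h
    · exact π.not_stuck_both _ h h'
  | repeatedReachability =>
    rcases h with ⟨ht, h⟩ | h <;> rcases h' with ⟨ht', n, hn⟩ | h'
    · obtain ⟨i, hi, hV⟩ := h n
      exact hn i hi hV
    · exact π.not_stuck_of_top ht _ h'
    · exact π.not_stuck_of_top ht' _ h
    · exact π.not_stuck_both _ h h'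

/-- If `R` is won by `P` and its complement by the opponent, both winning sets are known. -/
theorem winningSet_eq_of_subset (L : SymGame Q C M) (P : Player) (goal : Goal)
    (V R : Set (Conf Q C M)) (h : R ⊆ L.winningSet P goal V)
    (h' : Rᶜ ⊆ L.winningSet P.opponent goal.dual Vᶜ) :
    L.winningSet P goal V = R ∧ L.winningSet P.opponent goal.dual Vᶜ = Rᶜ := by
  have disj : ∀ σ, σ ∈ L.winningSet P goal V → σ ∈ L.winningSet P.opponent goal.dual Vᶜ →
      False := by
    rintro σ ⟨f, hf⟩ ⟨f', hf'⟩
    -- Two winning strategies played against each other would give one play that both players win.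
    obtain ⟨π, h0, h1, h2⟩ := L.exists_play f f' σ
    exact π.not_wonBy_both P goal V (hf π h0 h1) (hf' π h0 h2)
  refine ⟨Set.Subset.antisymm (fun σ hσ => ?_) h, Set.Subset.antisymm (fun σ hσ hR => ?_) h'⟩
  · by_contra hR
    exact disj σ hσ (h' hR)
  · exact disj σ (h hR) hσ

/-- A play that follows a strategy for `P` which picks good successors stays in `X` after a
configuration of `cpre P X`, unless the opponent is stuck. -/
theorem Play.next_mem_of_mem_cpre {L : SymGame Q C M} {P : Player} (π : L.Play)
    {X : Set (Conf Q C M)} {j : ℕ} (hj : (j : ℕ∞) ≤ π.len) (h : π.state j ∈ L.cpre P X)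
    (hgood : L.owner (π.state j).1 = P → (∃ ρ, L.Step (π.state j) ρ ∧ ρ ∈ X) →
      (j : ℕ∞) < π.len → π.state (j + 1) ∈ X) :
    (((j + 1 : ℕ) : ℕ∞) ≤ π.len ∧ π.state (j + 1) ∈ X) ∨ π.Stuck P.opponent := by
  rcases hj.lt_or_eq with hj | hj
  · refine .inl ⟨by rw [Nat.cast_add]; exact Order.add_one_le_of_lt hj, ?_⟩
    rcases h with ⟨ho, hρ⟩ | ⟨-, h⟩
    · exact hgood ho hρ hj
    · exact h _ (π.step j hj)
  · rcases h with ⟨-, ρ, hρ, -⟩ | ⟨ho, -⟩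
    · exact absurd ⟨ρ, hρ⟩ (π.maximal j hj.symm)
    · exact .inr ⟨j, hj.symm, ho⟩

/-! ### Winning strategies from fixpoint approximations -/

section Sound

variable (L : SymGame Q C M) (P : Player) {V R : Set (Conf Q C M)} {X : ℕ → Set (Conf Q C M)} {n : ℕ}

/-- The least index of an approximant containing the current configuration is a rank. Moving into
the approximant just below lowers it until `V` is reached or the opponent is stuck. -/
theorem subset_winningSet_reachability (h0 : X 0 = ∅)
    (hX : ∀ i < n, X (i + 1) ⊆ V ∪ L.cpre P (X i)) (hR : R ⊆ X n) :
    R ⊆ L.winningSet P .reachability V := by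
  intro σ hσ
  let rk (σ : Conf Q C M) : ℕ := sInf {i | σ ∈ X i}
  obtain ⟨f, hf⟩ := L.exists_positional P fun σ ρ => ρ ∈ X (rk σ - 1)
  refine ⟨f, fun π hπ hfol => ?_⟩
  have key : ∀ i ≤ n, ∀ j : ℕ, (j : ℕ∞) ≤ π.len → π.state j ∈ X i →
      π.WonBy P V .reachability := by
    -- The `X i` need not be increasing, so a move may lower the rank by more than one; hence strong
    -- induction.
    intro i
    induction i using Nat.strong_induction_on with
    | _ i ih =>
    intro hi j hj hji
    have hr : π.state j ∈ X (rk (π.state j)) := Nat.sInf_mem (s := {i | π.state j ∈ X i}) ⟨i, hji⟩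
    have hle : rk (π.state j) ≤ i := Nat.sInf_le hji
    have hf' := fun h => hf ((List.range j).map π.state) (π.state j) h
    generalize rk (π.state j) = r at hr hle hf'
    cases r with
    | zero => rw [h0] at hr; exact hr.elim
    | succ r =>
      rcases hX r (by omega) hr with hV | hc
      · exact .inl ⟨j, hj, hV⟩
      · rcases π.next_mem_of_mem_cpre hj hc
          (fun ho hρ hlt => by rw [hfol j hlt ho]; exact hf' hρ) with ⟨h1, h2⟩ | h
        · exact ih r (by omega) (by omega) _ h1 h2
        · exact .inr h
  exact key n le_rfl 0 (by simp) (hπ ▸ hR hσ)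

/-- The complement of a set closed under `cpre P` is a trap: there the opponent always has a move
that stays inside, and `P` has none that leaves. In particular the opponent never gets stuck. -/
theorem compl_subset_winningSet_invariant (hV : V ⊆ R) (hR : L.cpre P R ⊆ R) :
    Rᶜ ⊆ L.winningSet P.opponent .invariant Vᶜ := by
  have hR' : Rᶜ ⊆ L.cpre P.opponent Rᶜ := by
    intro σ hσ
    have h : σ ∉ L.cpre P R := fun h => hσ (hR h)
    rcases P.eq_or_eq_opponent (L.owner σ.1) with ho | ho
    · exact .inr ⟨by simpa using ho, fun ρ hρ hρR => h (.inl ⟨ho, ρ, hρ, hρR⟩)⟩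
    · refine .inl ⟨ho, ?_⟩
      by_contra hc
      push Not at hc
      exact h (.inr ⟨ho, fun ρ hρ => by simpa using hc ρ hρ⟩)
  intro σ hσ
  obtain ⟨f, hf⟩ := L.exists_positional P.opponent fun _ ρ => ρ ∈ Rᶜ
  refine ⟨f, fun π hπ hfol => ?_⟩
  have key : ∀ i : ℕ, (i : ℕ∞) ≤ π.len → π.state i ∈ Rᶜ := by
    intro i
    induction i with
    | zero => intro _; rwa [hπ]
    | succ i ih =>
      intro hi
      have hlt : (i : ℕ∞) < π.len := lt_of_lt_of_le (by exact_mod_cast i.lt_succ_self) hi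
      rcases hR' (ih hlt.le) with ⟨ho, h⟩ | ⟨-, h⟩
      · rw [hfol i hlt ho]
        exact hf _ _ h
      · exact h _ (π.step i hlt)
  refine ⟨fun i hi h => key i hi (hV h), ?_⟩
  rintro ⟨m, hm, ho⟩
  rcases hR' (key m hm.ge) with ⟨-, ρ, hρ, -⟩ | ⟨ho', -⟩
  · exact π.maximal m hm ⟨ρ, hρ⟩
  · exact P.opponent.opponent_ne (ho'.symm.trans ho)

/-- Each round starts in `R`, descends in rank to a configuration of `V` from which `R` can be
enforced again, and returns to `R`. -/
theorem subset_winningSet_repeatedReachability (h0 : X 0 = ∅)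
    (hX : ∀ i < n, X (i + 1) ⊆ (V ∩ L.cpre P R) ∪ L.cpre P (X i)) (hR : R ⊆ X n) :
    R ⊆ L.winningSet P .repeatedReachability V := by
  intro σ hσ
  let rk (σ : Conf Q C M) : ℕ := sInf {i | σ ∈ X i}
  obtain ⟨f, hf⟩ := L.exists_positional P fun σ ρ =>
    (σ ∈ V ∩ L.cpre P R → ρ ∈ R) ∧ (σ ∉ V ∩ L.cpre P R → ρ ∈ X (rk σ - 1))
  refine ⟨f, fun π hπ hfol => ?_⟩
  by_cases hs : π.Stuck P.opponent
  · exact .inr hs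
  have key : ∀ i ≤ n, ∀ j : ℕ, (j : ℕ∞) ≤ π.len → π.state j ∈ X i →
      ∃ j' : ℕ, j ≤ j' ∧ (j' : ℕ∞) ≤ π.len ∧ π.state j' ∈ V ∩ L.cpre P R := by
    intro i
    induction i using Nat.strong_induction_on with
    | _ i ih =>
    intro hi j hj hji
    by_cases hc : π.state j ∈ V ∩ L.cpre P R
    · exact ⟨j, le_rfl, hj, hc⟩
    have hr : π.state j ∈ X (rk (π.state j)) := Nat.sInf_mem (s := {i | π.state j ∈ X i}) ⟨i, hji⟩
    have hle : rk (π.state j) ≤ i := Nat.sInf_le hji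
    have hf' := fun h => hf ((List.range j).map π.state) (π.state j) h
    generalize rk (π.state j) = r at hr hle hf'
    cases r with
    | zero => rw [h0] at hr; exact hr.elim
    | succ r =>
      have hc' := (hX r (by omega) hr).resolve_left hc
      rcases π.next_mem_of_mem_cpre hj hc' (fun ho hρ hlt => by
          rw [hfol j hlt ho]
          obtain ⟨ρ, h1, h2⟩ := hρ
          exact (hf' ⟨ρ, h1, fun h => absurd h hc, fun _ => h2⟩).2 hc) with ⟨h1, h2⟩ | h
      · obtain ⟨j', h3, h4⟩ := ih r (by omega) (by omega) _ h1 h2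
        exact ⟨j', by omega, h4⟩
      · exact absurd h hs
  have key2 : ∀ j : ℕ, (j : ℕ∞) ≤ π.len → π.state j ∈ R → ∃ j' : ℕ, j ≤ j' ∧
      π.state j' ∈ V ∧ ((j' + 1 : ℕ) : ℕ∞) ≤ π.len ∧ π.state (j' + 1) ∈ R := by
    intro j hj hjR
    obtain ⟨j', h1, h2, h3⟩ := key n le_rfl j hj (hR hjR)
    refine ⟨j', h1, h3.1, (π.next_mem_of_mem_cpre h2 h3.2 fun ho hρ hlt => ?_).resolve_right hs⟩
    rw [hfol j' hlt ho]
    obtain ⟨ρ, h4, h5⟩ := hρ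
    exact (hf _ _ ⟨ρ, h4, fun _ => h5, fun h => absurd h3 h⟩).1 h3
  have key3 : ∀ N : ℕ, ∃ j : ℕ, N ≤ j ∧ (j : ℕ∞) ≤ π.len ∧ π.state j ∈ R := by
    intro N
    induction N with
    | zero => exact ⟨0, le_rfl, by simp, hπ ▸ hσ⟩
    | succ N ih =>
      obtain ⟨j, h1, h2, h3⟩ := ih
      obtain ⟨j', h4, -, h5, h6⟩ := key2 j h2 h3
      exact ⟨j' + 1, by omega, h5, h6⟩
  -- Rounds can be repeated forever, so the play has positions in `R` beyond every bound; this shows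
  -- both that it is infinite and that it meets `V` infinitely often.
  refine .inl ⟨?_, fun N => ?_⟩
  · refine ENat.eq_top_iff_forall_ge.2 fun N => ?_
    obtain ⟨j, h1, h2, -⟩ := key3 N
    exact le_trans (by exact_mod_cast h1) h2
  · obtain ⟨j, h1, h2, h3⟩ := key3 N
    obtain ⟨j', h4, h5, -⟩ := key2 j h2 h3
    exact ⟨j', h1.trans h4, h5⟩

end Sound

/-- The operator whose iterated fixpoints are the winning sets. For repeated reachability, `Y` is
used only below a move of the opponent. -/
def stepOp (L : SymGame Q C M) (P : Player) (buchi : Bool) (V Y X : Set (Conf Q C M)) :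
    Set (Conf Q C M) :=
  {σ | (σ ∈ V ∧ (buchi = true → (L.owner σ.1 = P ∧ σ ∈ L.cpre P (L.cpre P Y)) ∨
    (L.owner σ.1 = P.opponent ∧ σ ∈ L.cpre P Y))) ∨ σ ∈ L.cpre P X}

/-- The rank of a configuration is the first `j` at which it drops out of `Y j`. The opponent always
moves to a successor of least rank. Then the rank never grows, and in an infinite play each visit to
`V` makes it fall, so there are only finitely many visits. -/
theorem compl_subset_winningSet_persistence (L : SymGame Q C M) (P : Player)
    {V R : Set (Conf Q C M)} {Y : ℕ → Set (Conf Q C M)} {k : ℕ} (h0 : Y 0 = Set.univ)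
    (hY : ∀ j < k, L.stepOp P true V (Y j) (Y (j + 1)) ⊆ Y (j + 1)) (hR : Y k ⊆ R) :
    Rᶜ ⊆ L.winningSet P.opponent .persistence Vᶜ := by
  let rk (σ : Conf Q C M) : ℕ := sInf {j | σ ∉ Y j}
  let B : Set (Conf Q C M) := {σ | ∃ j ≤ k, σ ∉ Y j}
  have rk_le : ∀ {σ j}, σ ∉ Y j → rk σ ≤ j := fun h => Nat.sInf_le h
  have rk_succ : ∀ {σ}, σ ∈ B →
      ∃ j < k, rk σ = j + 1 ∧ σ ∉ L.stepOp P true V (Y j) (Y (j + 1)) := by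
    rintro σ ⟨i, hi, h⟩
    have h1 : σ ∉ Y (rk σ) := Nat.sInf_mem (s := {j | σ ∉ Y j}) ⟨i, h⟩
    have h2 := (rk_le h).trans hi
    generalize rk σ = r at h1 h2
    cases r with
    | zero => rw [h0] at h1; exact absurd (Set.mem_univ _) h1
    | succ j => exact ⟨j, h2, rfl, fun h3 => h1 (hY j h2 h3)⟩
  have opp : ∀ {σ : Conf Q C M} {X}, L.owner σ.1 = P.opponent → σ ∉ L.cpre P X →
      ∃ ρ, L.Step σ ρ ∧ ρ ∉ X := by
    intro σ X ho h
    by_contra hc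
    push Not at hc
    exact h (.inr ⟨ho, hc⟩)
  obtain ⟨f, hf⟩ := L.exists_positional P.opponent fun σ ρ =>
    ∀ ρ', L.Step σ ρ' → ρ' ∈ B → ρ ∈ B ∧ rk ρ ≤ rk ρ'
  have hmin : ∀ {h σ ρ'}, L.Step σ ρ' → ρ' ∈ B →
      f.next h σ ∈ B ∧ rk (f.next h σ) ≤ rk ρ' := by
    intro h σ ρ' h1 h2
    refine hf h σ ?_ ρ' h1 h2
    -- A successor of least rank exists as soon as some successor lies in `B`, ranks being natural
    -- numbers.
    obtain ⟨ρ, ⟨h3, h4⟩, h5⟩ := exists_minimalFor_of_wellFoundedLT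
      (fun ρ => L.Step σ ρ ∧ ρ ∈ B) rk ⟨ρ', h1, h2⟩
    exact ⟨ρ, h3, fun ρ'' h6 h7 => ⟨h4, (le_total (rk ρ) (rk ρ'')).elim id
      fun h8 => h5 ⟨h6, h7⟩ h8⟩⟩
  intro σ hσ
  refine ⟨f, fun π hπ hfol => ?_⟩
  have hcpre : ∀ i : ℕ, (i : ℕ∞) < π.len → ∀ j ≤ k, π.state i ∉ L.cpre P (Y j) →
      π.state (i + 1) ∈ B ∧ rk (π.state (i + 1)) ≤ j := by
    intro i hi j hj hc
    rcases P.eq_or_eq_opponent (L.owner (π.state i).1) with ho | ho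
    · have : π.state (i + 1) ∉ Y j := fun h => hc (.inl ⟨ho, _, π.step i hi, h⟩)
      exact ⟨⟨j, hj, this⟩, rk_le this⟩
    · obtain ⟨ρ, h1, h2⟩ := opp ho hc
      rw [hfol i hi ho]
      obtain ⟨h3, h4⟩ := hmin (h := (List.range i).map π.state) h1 ⟨j, hj, h2⟩
      exact ⟨h3, h4.trans (rk_le h2)⟩
  have hstep : ∀ i : ℕ, (i : ℕ∞) < π.len → π.state i ∈ B →
      π.state (i + 1) ∈ B ∧ rk (π.state (i + 1)) ≤ rk (π.state i) := by
    intro i hi hB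
    obtain ⟨j, hj, h1, h2⟩ := rk_succ hB
    rw [h1]
    exact hcpre i hi (j + 1) hj fun h => h2 (.inr h)
  -- The fall is measured over two moves, because at a configuration of `P` the operator `stepOp`
  -- refers to `Y` only after two moves.
  have hstepV : ∀ i : ℕ, π.len = ⊤ → π.state i ∈ B → π.state i ∈ V →
      rk (π.state (i + 2)) < rk (π.state i) := by
    intro i ht hB hV
    have hlt : ∀ i : ℕ, (i : ℕ∞) < π.len := fun i => by rw [ht]; exact ENat.natCast_lt_top i
    obtain ⟨j, hj, h1, h2⟩ := rk_succ hB
    rw [h1]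
    refine Nat.lt_succ_of_le ?_
    rcases P.eq_or_eq_opponent (L.owner (π.state i).1) with ho | ho
    · have h3 : π.state (i + 1) ∉ L.cpre P (Y j) := fun h =>
        h2 (.inl ⟨hV, fun _ => .inl ⟨ho, .inl ⟨ho, _, π.step i (hlt i), h⟩⟩⟩)
      exact (hcpre (i + 1) (hlt _) j hj.le h3).2
    · have h3 : π.state i ∉ L.cpre P (Y j) := fun h => h2 (.inl ⟨hV, fun _ => .inr ⟨ho, h⟩⟩)
      obtain ⟨h4, h5⟩ := hcpre i (hlt _) j hj.le h3
      exact (hstep (i + 1) (hlt _) h4).2.trans h5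
  have hB : ∀ i : ℕ, (i : ℕ∞) ≤ π.len → π.state i ∈ B := by
    intro i
    induction i with
    | zero => intro _; rw [hπ]; exact ⟨k, le_rfl, fun h => hσ (hR h)⟩
    | succ i ih =>
      intro hi
      have hlt : (i : ℕ∞) < π.len := lt_of_lt_of_le (by exact_mod_cast i.lt_succ_self) hi
      exact (hstep i hlt (ih hlt.le)).1
  rcases eq_or_ne π.len ⊤ with ht | ht
  · refine .inl ⟨ht, ?_⟩
    have hlt : ∀ i : ℕ, (i : ℕ∞) < π.len := fun i => by rw [ht]; exact ENat.natCast_lt_top i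
    have hanti : Antitone fun i => rk (π.state i) :=
      antitone_nat_of_succ_le fun i => (hstep i (hlt i) (hB i (hlt i).le)).2
    -- From a position `N` of minimal rank on, the rank is constant, which excludes further visits
    -- to `V`.
    obtain ⟨N, -, hN⟩ := exists_minimalFor_of_wellFoundedLT (fun _ : ℕ => True)
      (fun i => rk (π.state i)) ⟨0, trivial⟩
    refine ⟨N, fun i hi hV => ?_⟩
    have h1 := hstepV i ht (hB i (hlt i).le) hV
    have h2 : rk (π.state i) ≤ rk (π.state N) := hanti hi
    have h3 := hN (j := i + 2) trivial (h1.le.trans h2)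
    exact absurd (h1.trans_le h2) (not_lt.2 h3)
  · obtain ⟨m, hm⟩ := ENat.ne_top_iff_exists.1 ht
    refine .inr ⟨m, hm.symm, ?_⟩
    rcases P.eq_or_eq_opponent (L.owner (π.state m).1) with ho | ho
    · simpa using ho
    · obtain ⟨j, hj, -, h2⟩ := rk_succ (hB m hm.le)
      obtain ⟨ρ, h3, -⟩ := opp ho fun h => h2 (.inr h)
      exact absurd ⟨ρ, h3⟩ (π.maximal m hm.symm)

/-- A certificate that `Y k` is the winning set of `P`, for repeated reachability of `V` if
`buchi = true` and for reachability of `V` otherwise: `Y k` is contained in the least fixpoint of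
`stepOp`, by the approximants `X`, and contains the greatest one, by the approximants `Y`. -/
structure Certifies (L : SymGame Q C M) (P : Player) (buchi : Bool) (V : Set (Conf Q C M))
    (X Y : ℕ → Set (Conf Q C M)) (n k : ℕ) : Prop where
  X_zero : X 0 = ∅
  X_succ : ∀ i < n, X (i + 1) ⊆ L.stepOp P buchi V (Y k) (X i)
  subset_X : Y k ⊆ X n
  Y_zero : Y 0 = Set.univ
  Y_succ : ∀ j < k, L.stepOp P buchi V (Y j) (Y (j + 1)) ⊆ Y (j + 1)

/-- The goal that belongs to a Büchi flag. -/
def goalOf : Bool → Goal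
  | true => .repeatedReachability
  | false => .reachability

theorem Certifies.winningSet_eq {L : SymGame Q C M} {P : Player} {V : Set (Conf Q C M)}
    {X Y : ℕ → Set (Conf Q C M)} {n k : ℕ} {buchi : Bool}
    (h : L.Certifies P buchi V X Y n k) :
    L.winningSet P (goalOf buchi) V = Y k ∧
      L.winningSet P.opponent (goalOf buchi).dual Vᶜ = (Y k)ᶜ := by
  -- For `k = 0` the truncated index is harmless, since `Y 0` is everything.
  have hR : L.stepOp P buchi V (Y (k - 1)) (Y k) ⊆ Y k := by
    cases k with
    | zero => rw [h.Y_zero]; exact Set.subset_univ _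
    | succ k => exact h.Y_succ k k.lt_succ_self
  have hc : L.cpre P (Y k) ⊆ Y k := fun σ hσ => hR (.inr hσ)
  cases buchi with
  | false =>
    have hV : V ⊆ Y k := fun σ hσ => hR (.inl ⟨hσ, by simp⟩)
    refine winningSet_eq_of_subset L P _ V _ ?_ (L.compl_subset_winningSet_invariant P hV hc)
    exact L.subset_winningSet_reachability P h.X_zero
      (fun i hi σ hσ => (h.X_succ i hi hσ).imp (fun h => h.1) id) h.subset_X
  | true =>
    refine winningSet_eq_of_subset L P _ V _ ?_
      (L.compl_subset_winningSet_persistence P h.Y_zero h.Y_succ subset_rfl)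
    refine L.subset_winningSet_repeatedReachability P h.X_zero (fun i hi σ hσ => ?_) h.subset_X
    -- The extra move of lookahead disappears here: `Y k` is closed under `cpre P`, so `cpre P (cpre
    -- P (Y k))` lies in `cpre P (Y k)`.
    refine (h.X_succ i hi hσ).imp (fun ⟨h1, h2⟩ => ⟨h1, ?_⟩) id
    rcases h2 rfl with ⟨-, h2⟩ | ⟨-, h2⟩
    · exact L.cpre_mono P hc h2
    · exact h2

end SymGame
/-! ### Right congruences of finite index -/

section Congruence

variable {Q C M S : Type*}

/-- The kernel of `f` is a right congruence on words. -/
def IsRightCongruence (f : List M → S) : Prop :=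
  ∀ w w' m, f w = f w' → f (w ++ [m]) = f (w' ++ [m])

/-- `T` is a union of classes of the channelwise kernel of `f`. -/
def Respects (f : List M → S) (T : Set (Conf Q C M)) : Prop :=
  ∀ q w w', (∀ c, f (w c) = f (w' c)) → (q, w) ∈ T → (q, w') ∈ T

/-- A refinement of `f` that suffices for predecessors. -/
def refine (f : List M → S) (w : List M) : S × Set S × Option M × Set S :=
  (f w, f '' {u | u.Sublist w}, w.head?, f '' {u | u.Sublist w.tail})

theorem IsRightCongruence.append {f : List M → S} (hf : IsRightCongruence f) {w w' : List M}
    (h : f w = f w') (z : List M) : f (w ++ z) = f (w' ++ z) := by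
  induction z generalizing w w' with
  | nil => simpa
  | cons m z ih => simpa using ih (hf w w' m h)

/-- A subword of `w ++ [m]` splits into a subword of `w` and one of `[m]`; only the first factor has
to be exchanged, and right congruence preserves the class after the second. -/
theorem image_sublist_concat_subset {f : List M → S} (hf : IsRightCongruence f) {w w' : List M}
    (m : M) (h : f '' {u | u.Sublist w} ⊆ f '' {u | u.Sublist w'}) :
    f '' {u | u.Sublist (w ++ [m])} ⊆ f '' {u | u.Sublist (w' ++ [m])} := by
  rintro _ ⟨u, hu, rfl⟩
  obtain ⟨u₁, u₂, rfl, h₁, h₂⟩ := List.sublist_append_iff.1 hu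
  obtain ⟨u', hu', he⟩ := h ⟨u₁, h₁, rfl⟩
  exact ⟨u' ++ u₂, List.Sublist.append hu' h₂, hf.append he u₂⟩

theorem image_sublist_concat {f : List M → S} (hf : IsRightCongruence f) {w w' : List M} (m : M)
    (h : f '' {u | u.Sublist w} = f '' {u | u.Sublist w'}) :
    f '' {u | u.Sublist (w ++ [m])} = f '' {u | u.Sublist (w' ++ [m])} :=
  (image_sublist_concat_subset hf m h.subset).antisymm
    (image_sublist_concat_subset hf m h.superset)

theorem IsRightCongruence.refine {f : List M → S} (hf : IsRightCongruence f) :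
    IsRightCongruence (refine f) := by
  intro w w' m h
  simp only [LCS.refine, Prod.mk.injEq] at h ⊢
  obtain ⟨h1, h2, h3, h4⟩ := h
  refine ⟨hf _ _ _ h1, image_sublist_concat hf m h2, ?_, ?_⟩
  · cases w <;> cases w' <;> simp_all
  · cases w <;> cases w' <;> simp_all
    exact image_sublist_concat hf m h4

theorem Respects.refine {f : List M → S} {T : Set (Conf Q C M)} (h : Respects f T) :
    Respects (refine f) T :=
  fun q w w' he => h q w w' fun c => congrArg Prod.fst (he c)

theorem Respects.compl {f : List M → S} {T : Set (Conf Q C M)} (h : Respects f T) :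
    Respects f Tᶜ :=
  fun q w w' he hw hw' => hw (h q w' w (fun c => (he c).symm) hw')

theorem respects_empty (f : List M → S) : Respects f (∅ : Set (Conf Q C M)) :=
  fun _ _ _ _ => id

theorem respects_univ (f : List M → S) : Respects f (Set.univ : Set (Conf Q C M)) :=
  fun _ _ _ _ => id

/-- This is what the components of `refine` are made for: the head decides whether a receive is
possible, the subwords of the tail describe its result, and the subwords of the word itself cover
sends and untouched channels. -/
theorem Op.Effect.transfer {f : List M → S} (hf : IsRightCongruence f) {op : Op C M}
    {w w' u : C → List M} (he : ∀ c, LCS.refine f (w c) = LCS.refine f (w' c))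
    (h : op.Effect w u) :
    ∃ u', op.Effect w' u' ∧ ∀ c, f '' {v | v.Sublist (u c)} = f '' {v | v.Sublist (u' c)} := by
  classical
  simp only [LCS.refine, Prod.mk.injEq] at he
  cases op with
  | send c m =>
    obtain ⟨h1, h2⟩ := h
    refine ⟨Function.update w' c (w' c ++ [m]), ⟨by simp, fun d hd => by simp [hd]⟩, fun d => ?_⟩
    rcases eq_or_ne d c with rfl | hd
    · rw [h1, Function.update_self]
      exact image_sublist_concat hf m (he d).2.1
    · rw [h2 d hd, Function.update_of_ne hd]
      exact (he d).2.1
  | recv c m =>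
    obtain ⟨h1, h2⟩ := h
    obtain ⟨-, -, h3, h4⟩ := he c
    rw [h1] at h3 h4
    obtain ⟨t, ht⟩ : ∃ t, w' c = m :: t := by
      cases hw : w' c with
      | nil => simp [hw] at h3
      | cons a t => simp only [hw, List.head?_cons, Option.some.injEq] at h3; exact ⟨t, by rw [h3]⟩
    rw [ht] at h4
    refine ⟨Function.update w' c t, ⟨by simp [ht], fun d hd => by simp [hd]⟩, fun d => ?_⟩
    rcases eq_or_ne d c with rfl | hd
    · rw [Function.update_self]
      exact h4
    · rw [h2 d hd, Function.update_of_ne hd]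
      exact (he d).2.1
  | internal =>
    cases h
    exact ⟨w', rfl, fun c => (he c).2.1⟩

/-- After equivalent perfect steps the same classes of subwords are available, so the losses can be
imitated up to `f`. -/
theorem GLCS.Step.transfer {L : GLCS Q C M} {f : List M → S} (hf : IsRightCongruence f)
    (hG : ∀ δ ∈ L.rules, Respects f δ.guard) {q : Q} {w w' : C → List M} {ρ : Conf Q C M}
    (he : ∀ c, LCS.refine f (w c) = LCS.refine f (w' c)) (h : L.Step (q, w) ρ) :
    ∃ v, L.Step (q, w') (ρ.1, v) ∧ ∀ c, f (ρ.2 c) = f (v c) := by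
  obtain ⟨δ, hδ, ⟨p, u⟩, ⟨h1, h2, h3, h4⟩, h5, h6⟩ := h
  obtain ⟨u', h7, h8⟩ := h4.transfer hf he
  have : ∀ c, ∃ v, v.Sublist (u' c) ∧ f (ρ.2 c) = f v := fun c => by
    have : f (ρ.2 c) ∈ f '' {v | v.Sublist (u' c)} := h8 c ▸ ⟨_, h6 c, rfl⟩
    obtain ⟨v, h9, h10⟩ := this
    exact ⟨v, h9, h10.symm⟩
  choose v hv hfv using this
  exact ⟨v, ⟨δ, hδ, (p, u'), ⟨(hG δ hδ).refine q w w' he h1, h2, h3, h7⟩, h5, hv⟩, hfv⟩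

theorem Respects.cpre {L : SymGame Q C M} {f : List M → S} (hf : IsRightCongruence f)
    (hG : ∀ δ ∈ L.rules, Respects f δ.guard) (P : Player) {X : Set (Conf Q C M)}
    (hX : Respects f X) : Respects (LCS.refine f) (L.cpre P X) := by
  rintro q w w' he (⟨h1, ρ, h2, h3⟩ | ⟨h1, h2⟩)
  · obtain ⟨v, h4, h5⟩ := h2.transfer hf hG he
    exact .inl ⟨h1, _, h4, hX _ _ _ h5 h3⟩
  · refine .inr ⟨h1, fun ρ hρ => ?_⟩
    obtain ⟨v, h4, h5⟩ := hρ.transfer hf hG fun c => (he c).symm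
    exact hX _ _ _ (fun c => (h5 c).symm) (h2 _ h4)

/-- Two refinements are needed because `cpre` is nested twice in `stepOp`. -/
theorem Respects.stepOp {L : SymGame Q C M} {f : List M → S} (hf : IsRightCongruence f)
    (hG : ∀ δ ∈ L.rules, Respects f δ.guard) (P : Player) (buchi : Bool)
    {V X Y : Set (Conf Q C M)} (hV : Respects f V) (hY : Respects f Y) (hX : Respects f X) :
    Respects (LCS.refine (LCS.refine f)) (L.stepOp P buchi V Y X) := by
  rintro q w w' he (⟨h1, h2⟩ | h)
  · refine .inl ⟨hV.refine.refine q w w' he h1, fun hb => (h2 hb).imp ?_ ?_⟩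
    · exact fun h => ⟨h.1, (hY.cpre hf hG P).cpre hf.refine (fun δ hδ => (hG δ hδ).refine) P
        q w w' he h.2⟩
    · exact fun h => ⟨h.1, (hY.cpre hf hG P).refine q w w' he h.2⟩
  · exact .inr ((hX.cpre hf hG P).refine q w w' he h)

/-- Pumping: in a long word two prefixes fall into the same class, and the factor between them can
be cut out. -/
theorem IsRightCongruence.exists_short {f : List M → S} (hf : IsRightCongruence f) [Finite S]
    (w : List M) : ∃ u : List M, f u = f w ∧ u.length < Nat.card S := by
  induction hn : w.length using Nat.strong_induction_on generalizing w with
  | _ n ih =>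
  subst hn
  rcases lt_or_ge w.length (Nat.card S) with h | h
  · exact ⟨w, rfl, h⟩
  have := Fintype.ofFinite S
  obtain ⟨i, j, hij, he⟩ := Fintype.exists_ne_map_eq_of_card_lt
    (fun i : Fin (w.length + 1) => f (w.take i))
    (by rw [Fintype.card_fin, ← Nat.card_eq_fintype_card]; omega)
  wlog hlt : i < j generalizing i j
  · exact this j i hij.symm he.symm (lt_of_le_of_ne (not_lt.1 hlt) hij.symm)
  have hlt' : (i : ℕ) < j := hlt
  have h1 : f (w.take i ++ w.drop j) = f w := by
    conv_rhs => rw [← List.take_append_drop j w]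
    exact hf.append he _
  have hj := j.2
  have h2 : (w.take i ++ w.drop j).length < w.length := by
    simp only [List.length_append, List.length_take, List.length_drop]
    omega
  obtain ⟨u, h3, h4⟩ := ih _ h2 _ rfl
  exact ⟨u, h3.trans h1, h4⟩

end Congruence

/-! ### Regions are the sets that respect a right congruence of finite index -/

section Region

variable {Q C M : Type}

theorem IsRightCongruence.isRegular {S : Type} [Finite S] {f : List M → S}
    (hf : IsRightCongruence f) (s : S) : Language.IsRegular {w | f w = s} := by
  classical
  let D : DFA M S :=
    -- The transition uses any representative of the class, which is well defined by congruence;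
    -- states outside the range of `f` are never reached.
    { step := fun s m => if h : ∃ w, f w = s then f (h.choose ++ [m]) else s
      start := f []
      accept := {s} }
  have hD : ∀ w, D.eval w = f w := by
    intro w
    induction w using List.reverseRecOn with
    | nil => rfl
    | append_singleton w m ih =>
      rw [DFA.eval_append_singleton, ih]
      have h : ∃ w', f w' = f w := ⟨w, rfl⟩
      simp only [D, h, dif_pos]
      exact hf _ _ m h.choose_spec
  refine ⟨S, Fintype.ofFinite S, D, ?_⟩
  ext w
  rw [DFA.mem_accepts, hD]
  rfl

theorem Respects.isRegion [Finite Q] [Finite C] {S : Type} [Finite S] {f : List M → S}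
    (hf : IsRightCongruence f) {T : Set (Conf Q C M)} (hT : Respects f T) : IsRegion T := by
  -- One product per tuple of a location and channelwise classes that occurs in `T`; saturation
  -- gives the inclusion of these products in `T`.
  let I := {p : Q × (C → S) // ∃ w, (∀ c, f (w c) = p.2 c) ∧ (p.1, w) ∈ T}
  have e : I ≃ Fin (Nat.card I) := Finite.equivFin I
  refine ⟨Nat.card I, fun i => (e.symm i).1.1, fun i c => {w | f w = (e.symm i).1.2 c},
    fun i c => hf.isRegular _, ?_⟩
  ext ⟨q, w⟩
  constructor
  · intro h
    refine ⟨e ⟨(q, fun c => f (w c)), w, fun _ => rfl, h⟩, ?_⟩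
    simp only [Equiv.symm_apply_apply]
    exact ⟨trivial, fun c => rfl⟩
  · rintro ⟨i, h1, h2⟩
    obtain ⟨w', h3, h4⟩ := (e.symm i).2
    obtain rfl : q = _ := h1
    exact hT _ w' w (fun c => (h3 c).trans (h2 c).symm) h4

/-- All automata of the region are run in parallel on every channel, so that a single congruence
serves all channels. -/
theorem IsRegion.exists_respects [Finite C] {V : Set (Conf Q C M)} (hV : IsRegion V) :
    ∃ (S : Type) (_ : Finite S) (f : List M → S), IsRightCongruence f ∧ Respects f V := by
  obtain ⟨n, q, R, hR, rfl⟩ := hV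
  choose S hS D hD using fun p : Fin n × C => hR p.1 p.2
  refine ⟨∀ p, S p, inferInstance, fun w p => (D p).eval w, ?_, ?_⟩
  · intro w w' m h
    funext p
    simp only [DFA.eval_append_singleton]
    rw [show (D p).eval w = (D p).eval w' from congrFun h p]
  · rintro q w w' h ⟨i, h1, h2⟩
    refine ⟨i, h1, fun c => ?_⟩
    have h3 := h2 c
    rw [← hD (i, c), DFA.mem_accepts] at h3 ⊢
    have h4 : (D (i, c)).eval (w c) = _ := congrFun (h c) (i, c)
    rwa [h4] at h3

theorem exists_respects_of_finite [Finite C] {𝒱 : Set (Set (Conf Q C M))} (hfin : 𝒱.Finite)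
    (h𝒱 : ∀ V ∈ 𝒱, IsRegion V) :
    ∃ (S : Type) (_ : Finite S) (f : List M → S), IsRightCongruence f ∧
      ∀ V ∈ 𝒱, Respects f V := by
  induction 𝒱, hfin using Set.Finite.induction_on with
  | empty => exact ⟨Unit, inferInstance, fun _ => (), fun _ _ _ _ => rfl, by simp⟩
  | @insert V 𝒱 _ _ ih =>
    obtain ⟨S, _, f, hf, hfV⟩ := ih fun V hV => h𝒱 V (.inr hV)
    obtain ⟨S', _, f', hf', hfV'⟩ := (h𝒱 V (.inl rfl)).exists_respects
    refine ⟨S × S', inferInstance, fun w => (f w, f' w), ?_, ?_⟩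
    · intro w w' m h
      rw [Prod.mk.injEq] at h ⊢
      exact ⟨hf _ _ m h.1, hf' _ _ m h.2⟩
    · rintro U (rfl | hU) q w w' h
      · exact hfV' q w w' fun c => congrArg Prod.snd (h c)
      · exact hfV U hU q w w' fun c => congrArg Prod.fst (h c)

theorem GLCS.Step.of_sub {L : GLCS Q C M} {σ ρ ρ' : Conf Q C M} (h : L.Step σ ρ)
    (h' : ρ'.Sub ρ) : L.Step σ ρ' := by
  obtain ⟨δ, hδ, σ', h1, h2, h3⟩ := h
  exact ⟨δ, hδ, σ', h1, h'.1.trans h2, fun c => (h'.2 c).trans (h3 c)⟩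

theorem Conf.Sub.rfl {σ : Conf Q C M} : σ.Sub σ := ⟨Eq.refl _, fun _ => .refl _⟩

theorem Conf.Sub.trans {ρ σ τ : Conf Q C M} (h : ρ.Sub σ) (h' : σ.Sub τ) : ρ.Sub τ :=
  ⟨h.1.trans h'.1, fun c => (h.2 c).trans (h'.2 c)⟩

/-! ### Approximants of the inner fixpoint -/

namespace SymGame

variable (L : SymGame Q C M) (P : Player) (buchi : Bool) {V : Set (Conf Q C M)}

theorem stepOp_mono {Y Y' X X' : Set (Conf Q C M)} (hY : Y ⊆ Y') (hX : X ⊆ X') :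
    L.stepOp P buchi V Y X ⊆ L.stepOp P buchi V Y' X' := by
  rintro σ (⟨h1, h2⟩ | h)
  · refine .inl ⟨h1, fun hb => (h2 hb).imp (fun h => ⟨h.1, ?_⟩) fun h => ⟨h.1, ?_⟩⟩
    · exact L.cpre_mono P (L.cpre_mono P hY) h.2
    · exact L.cpre_mono P hY h.2
  · exact .inr (L.cpre_mono P hX h)

/-- The approximants of the least fixpoint of `stepOp`. -/
def approx (V Y : Set (Conf Q C M)) (i : ℕ) : Set (Conf Q C M) :=
  (L.stepOp P buchi V Y)^[i] ∅

theorem approx_succ (Y : Set (Conf Q C M)) (i : ℕ) :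
    L.approx P buchi V Y (i + 1) = L.stepOp P buchi V Y (L.approx P buchi V Y i) :=
  Function.iterate_succ_apply' _ _ _

theorem approx_monotone (Y : Set (Conf Q C M)) : Monotone (L.approx P buchi V Y) := by
  refine monotone_nat_of_le_succ fun i => ?_
  induction i with
  | zero => exact Set.empty_subset _
  | succ i ih =>
    rw [approx_succ, approx_succ]
    exact L.stepOp_mono P buchi subset_rfl ih

theorem approx_mono {Y Y' : Set (Conf Q C M)} (h : Y ⊆ Y') (i : ℕ) :
    L.approx P buchi V Y i ⊆ L.approx P buchi V Y' i := by
  induction i with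
  | zero => exact subset_rfl
  | succ i ih =>
    rw [approx_succ, approx_succ]
    exact L.stepOp_mono P buchi h ih

/-- The least fixpoint of `stepOp`. -/
def lfpOp (V Y : Set (Conf Q C M)) : Set (Conf Q C M) :=
  ⋃ i, L.approx P buchi V Y i

end SymGame

variable [Finite Q] [Finite C]

theorem IsRegion.compl {V : Set (Conf Q C M)} (hV : IsRegion V) : IsRegion Vᶜ := by
  obtain ⟨S, _, f, hf, h⟩ := hV.exists_respects
  exact h.compl.isRegion hf

theorem isRegion_empty : IsRegion (∅ : Set (Conf Q C M)) :=
  (respects_empty (fun _ => ())).isRegion fun _ _ _ _ => rfl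

theorem isRegion_univ : IsRegion (Set.univ : Set (Conf Q C M)) :=
  (respects_univ (fun _ => ())).isRegion fun _ _ _ _ => rfl

theorem SymGame.isRegion_stepOp [Finite M] (L : SymGame Q C M) (P : Player) (buchi : Bool)
    {V Y X : Set (Conf Q C M)} (hV : IsRegion V) (hY : IsRegion Y) (hX : IsRegion X) :
    IsRegion (L.stepOp P buchi V Y X) := by
  obtain ⟨S, _, f, hf, h⟩ := exists_respects_of_finite
    (𝒱 := Rule.guard '' L.rules ∪ {V, Y, X})
    ((L.finite_rules.image _).union (Set.toFinite _)) (by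
      rintro _ (⟨δ, hδ, rfl⟩ | rfl | rfl | rfl)
      exacts [L.guard_isRegion δ hδ, hV, hY, hX])
  exact (Respects.stepOp hf (fun δ hδ => h _ (.inl ⟨δ, hδ, rfl⟩)) P buchi (h V (by simp))
    (h Y (by simp)) (h X (by simp))).isRegion hf.refine.refine

/-! ### Termination of the fixpoint iterations -/

theorem Conf.wellQuasiOrdered_sub [Finite M] :
    WellQuasiOrdered (Conf.Sub : Conf Q C M → Conf Q C M → Prop) := by
  have h1 : WellQuasiOrdered (List.Sublist : List M → List M → Prop) := by
    -- Higman's lemma over the finite alphabet `M` ordered by equality; the channels and locations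
    -- are then added by finite products.
    have h := Set.PartiallyWellOrderedOn.partiallyWellOrderedOn_sublistForall₂ (Eq : M → M → Prop)
      (s := Set.univ) (Set.toFinite _).partiallyWellOrderedOn
    have h2 : {l : List M | ∀ x ∈ l, x ∈ Set.univ} = Set.univ := by ext; simp
    rw [h2, Set.partiallyWellOrderedOn_univ_iff] at h
    intro f
    obtain ⟨m, n, hmn, hs⟩ := h f
    refine ⟨m, n, hmn, ?_⟩
    obtain ⟨l, h3, h4⟩ := List.sublistForall₂_iff.1 hs
    rw [List.forall₂_eq_eq_eq] at h3
    rwa [h3]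
  have h2 : WellQuasiOrdered (Eq : Q → Q → Prop) := by
    rw [← Set.partiallyWellOrderedOn_univ_iff]
    exact (Set.toFinite _).partiallyWellOrderedOn
  have : IsPreorder (List M) List.Sublist :=
    { refl := List.Sublist.refl, trans := fun _ _ _ => List.Sublist.trans }
  have h3 : WellQuasiOrdered fun w w' : C → List M => ∀ c, (w c).Sublist (w' c) :=
    WellQuasiOrdered.pi (r := fun _ : C => List.Sublist) fun _ => h1
  exact h2.prod h3

theorem exists_stable_of_upwardClosed [Finite M] {U : ℕ → Set (Conf Q C M)} (hmono : Monotone U)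
    (hup : ∀ n σ τ, σ ∈ U n → σ.Sub τ → τ ∈ U n) : ∃ n, ∀ m, n ≤ m → U m = U n := by
  by_contra! hc
  have : ∀ n, ∃ m x, n ≤ m ∧ x ∈ U m ∧ x ∉ U n := by
    intro n
    obtain ⟨m, hm, hne⟩ := hc n
    obtain ⟨x, hx⟩ := Set.not_subset.1 fun h => hne (h.antisymm (hmono hm))
    exact ⟨m, x, hm, hx⟩
  -- Without stabilisation each stage misses a point that enters later. Along the stages `N i`,
  -- comparable points `x (N i)` and `x (N j)` with `i < j` would put `x (N j)` into `U (N j)`.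
  choose g x hg hx hx' using this
  let N : ℕ → ℕ := fun i => g^[i] 0
  have hN : ∀ i, N (i + 1) = g (N i) := fun i => Function.iterate_succ_apply' g i 0
  have hmN : Monotone N := monotone_nat_of_le_succ fun i => by rw [hN]; exact hg _
  obtain ⟨i, j, hij, hs⟩ := Conf.wellQuasiOrdered_sub fun i => x (N i)
  refine hx' (N j) (hup _ _ _ (hmono (hmN (Nat.succ_le_of_lt hij)) ?_) hs)
  rw [hN]
  exact hx _

/-! ### Stabilisation of both iterations -/

namespace SymGame

variable [Finite M] (L : SymGame Q C M) (P : Player) (buchi : Bool) {V : Set (Conf Q C M)}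

theorem isRegion_approx {Y : Set (Conf Q C M)} (hV : IsRegion V) (hY : IsRegion Y) (i : ℕ) :
    IsRegion (L.approx P buchi V Y i) := by
  induction i with
  | zero => exact isRegion_empty
  | succ i ih => rw [approx_succ]; exact L.isRegion_stepOp P buchi hV hY ih

/-- Only the upward closures of the opponent's parts have to stabilise: `P` can lose messages to
reach a smaller configuration that was already present at stage `n`. -/
theorem exists_approx_eq (Y : Set (Conf Q C M)) :
    ∃ n, L.approx P buchi V Y (n + 1) = L.approx P buchi V Y n := by
  have hmono := L.approx_monotone P buchi (V := V) Y
  set X := L.approx P buchi V Y with hX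
  have hsucc : ∀ i, X (i + 1) = L.stepOp P buchi V Y (X i) := L.approx_succ P buchi Y
  obtain ⟨n, hn⟩ := exists_stable_of_upwardClosed
    (U := fun i => {τ | ∃ ρ : Conf Q C M, ρ.Sub τ ∧ ρ ∈ X i ∧ L.owner ρ.1 = P.opponent})
    (fun i j hij τ ⟨ρ, h1, h2, h3⟩ => ⟨ρ, h1, hmono hij h2, h3⟩)
    (fun i σ τ ⟨ρ, h1, h2⟩ h => ⟨ρ, h1.trans h, h2⟩)
  have h1 : ∀ m, n ≤ m → ∀ σ, L.owner σ.1 = P → σ ∈ X (m + 1) → σ ∈ X (n + 1) := by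
    intro m hm σ ho hσ
    rw [hsucc] at hσ ⊢
    refine hσ.imp id ?_
    rintro (⟨-, ρ, h2, h3⟩ | ⟨ho', -⟩)
    · have hρ : L.owner ρ.1 = P.opponent := by rw [L.owner_step h2, ho]
      obtain ⟨ρ', h4, h5, -⟩ := (hn m hm).subset ⟨ρ, Conf.Sub.rfl, h3, hρ⟩
      exact .inl ⟨ho, ρ', h2.of_sub h4, h5⟩
    · exact absurd (ho'.symm.trans ho) P.opponent_ne
  -- The closures are stable from `n` on, hence the configurations of `P` from `n + 1` on, and those
  -- of the opponent one step later.
  refine ⟨n + 2, Set.Subset.antisymm (fun σ hσ => ?_) (hmono (Nat.le_succ _))⟩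
  rcases P.eq_or_eq_opponent (L.owner σ.1) with ho | ho
  · exact hmono (Nat.le_succ _) (h1 (n + 2) (by omega) σ ho hσ)
  · rw [hsucc] at hσ ⊢
    refine hσ.imp id ?_
    rintro (⟨ho', -⟩ | ⟨-, h2⟩)
    · exact absurd (ho.symm.trans ho') P.opponent_ne
    · exact .inr ⟨ho, fun ρ hρ => h1 (n + 1) (by omega) ρ
        (by rw [L.owner_step hρ, ho, Player.opponent_opponent]) (h2 ρ hρ)⟩

theorem exists_lfpOp_eq (V Y : Set (Conf Q C M)) :
    ∃ n, L.lfpOp P buchi V Y = L.approx P buchi V Y n ∧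
      L.stepOp P buchi V Y (L.approx P buchi V Y n) = L.approx P buchi V Y n := by
  obtain ⟨n, hn⟩ := L.exists_approx_eq P buchi (V := V) Y
  refine ⟨n, Set.Subset.antisymm (Set.iUnion_subset fun i => ?_)
    (Set.subset_iUnion (L.approx P buchi V Y) n), by rw [← approx_succ, hn]⟩
  induction i with
  | zero => exact Set.empty_subset _
  | succ i ih =>
    rw [approx_succ]
    refine (L.stepOp_mono P buchi subset_rfl ih).trans ?_
    rw [← approx_succ, hn]

/-- Winning sets of regions have certificates that consist of regions. -/
theorem exists_certifies (hV : IsRegion V) : ∃ X Y n k, L.Certifies P buchi V X Y n k ∧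
    (∀ i, IsRegion (X i)) ∧ ∀ j, IsRegion (Y j) := by
  let Y : ℕ → Set (Conf Q C M) := fun j => (L.lfpOp P buchi V)^[j] Set.univ
  have hY : ∀ j, Y (j + 1) = L.lfpOp P buchi V (Y j) := fun j => Function.iterate_succ_apply' _ _ _
  have hanti : Antitone Y := by
    refine antitone_nat_of_succ_le fun j => ?_
    induction j with
    | zero => exact Set.subset_univ _
    | succ j ih =>
      rw [hY (j + 1)]
      nth_rewrite 2 [hY j]
      exact Set.iUnion_mono fun i => L.approx_mono P buchi ih i
  have hreg : ∀ j, IsRegion (Y j) := by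
    intro j
    induction j with
    | zero => exact isRegion_univ
    | succ j ih =>
      obtain ⟨n, hn, -⟩ := L.exists_lfpOp_eq P buchi V (Y j)
      rw [hY, hn]
      exact L.isRegion_approx P buchi hV ih n
  -- The `Y j` decrease, so the chain that increases consists of the upward closures of what `P`
  -- owns outside `Y j`.
  obtain ⟨n, hn⟩ := exists_stable_of_upwardClosed
    (U := fun i => {τ | ∃ ρ : Conf Q C M, ρ.Sub τ ∧ ρ ∉ Y i ∧ L.owner ρ.1 = P})
    (fun i j hij τ ⟨ρ, h1, h2, h3⟩ => ⟨ρ, h1, fun h => h2 (hanti hij h), h3⟩)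
    (fun i σ τ ⟨ρ, h1, h2⟩ h => ⟨ρ, h1.trans h, h2⟩)
  have h1 : ∀ σ, L.owner σ.1 = P.opponent → σ ∈ L.cpre P (Y n) → σ ∈ L.cpre P (Y (n + 1)) := by
    rintro σ ho (⟨ho', -⟩ | ⟨-, h⟩)
    · exact absurd (ho.symm.trans ho') P.opponent_ne
    refine .inr ⟨ho, fun ρ hρ => ?_⟩
    by_contra hc
    obtain ⟨ρ', h2, h3, -⟩ := (hn (n + 1) (Nat.le_succ _)).subset ⟨ρ, Conf.Sub.rfl, hc,
      by rw [L.owner_step hρ, ho, Player.opponent_opponent]⟩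
    exact h3 (h _ (hρ.of_sub h2))
  -- `Y` occurs in `stepOp` only through `cpre P Y` at configurations of the opponent, where the
  -- previous step applies. The sets `Y n` and `Y (n + 1)` themselves need not agree.
  have h2 : ∀ X, L.stepOp P buchi V (Y n) X ⊆ L.stepOp P buchi V (Y (n + 1)) X := by
    rintro X σ (⟨h2, h3⟩ | h)
    · refine .inl ⟨h2, fun hb => (h3 hb).imp ?_ fun h => ⟨h.1, h1 σ h.1 h.2⟩⟩
      rintro ⟨ho, ⟨-, ρ, h4, h5⟩ | ⟨ho', -⟩⟩
      · exact ⟨ho, .inl ⟨ho, ρ, h4, h1 ρ (by rw [L.owner_step h4, ho]) h5⟩⟩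
      · exact absurd (ho'.symm.trans ho) P.opponent_ne
    · exact .inr h
  have h3 : L.stepOp P buchi V (Y (n + 1)) = L.stepOp P buchi V (Y n) :=
    funext fun X => (L.stepOp_mono P buchi (hanti (Nat.le_succ n)) subset_rfl).antisymm (h2 X)
  have h4 : L.lfpOp P buchi V (Y (n + 1)) = L.lfpOp P buchi V (Y n) := by
    unfold lfpOp approx
    rw [h3]
  -- Equal operators have equal least fixpoints, so `Y (n + 1)` is its own image and `k = n + 1`
  -- works.
  obtain ⟨m, hm, -⟩ := L.exists_lfpOp_eq P buchi V (Y (n + 1))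
  refine ⟨L.approx P buchi V (Y (n + 1)), Y, m, n + 1, ⟨rfl, fun i _ => ?_, ?_, rfl, fun j _ => ?_⟩,
    L.isRegion_approx P buchi hV (hreg _), hreg⟩
  · rw [approx_succ]
  · rw [← hm, h4, ← hY]
  · obtain ⟨i, hi, hi'⟩ := L.exists_lfpOp_eq P buchi V (Y j)
    rw [hY, hi, hi']

end SymGame

end Region
/-! ### Games on codes of configurations -/

namespace Code

/-- The states that the automaton `a` can reach on the word `w`. -/
def run (a : AutCode) (w : List ℕ) : List ℕ :=
  w.foldl (fun S m => (a.2.1.filter fun t => t.1 ∈ S ∧ t.2.1 = m).map fun t => t.2.2) a.1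

theorem mem_run (a : AutCode) (w : List ℕ) (s : ℕ) : s ∈ run a w ↔ s ∈ a.toNFA.eval w := by
  induction w using List.reverseRecOn generalizing s with
  | nil => rfl
  | append_singleton w m ih =>
    rw [NFA.eval_append_singleton, NFA.mem_stepSet, run, List.foldl_concat, ← run]
    simp only [List.mem_map, List.mem_filter, decide_eq_true_eq, ih, AutCode.toNFA]
    constructor
    · rintro ⟨⟨p, m', q⟩, ⟨h1, h2, rfl⟩, rfl⟩
      exact ⟨p, h2, h1⟩
    · rintro ⟨p, h1, h2⟩
      exact ⟨(p, m, s), ⟨h2, h1, rfl⟩, rfl⟩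

/-- The word `w` is accepted by the automaton `a`. -/
def Accepts (a : AutCode) (w : List ℕ) : Prop := ∃ s ∈ run a w, s ∈ a.2.2

theorem accepts_iff (a : AutCode) (w : List ℕ) : Accepts a w ↔ w ∈ a.toNFA.accepts := by
  simp only [Accepts, mem_run, NFA.accepts, and_comm]
  rfl

/-- The configuration with code `s` is in the region with code `R`. -/
def Mem (R : RegionCode) (s : ConfCode) : Prop :=
  ∃ r ∈ R, r.1 = s.1 ∧
    ∀ j < s.2.length, Accepts (r.2.getD j ([], [], [])) (s.2.getD j [])

/-- The contents of the channels after a perfect operation, given as a list of length at most 1. -/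
def perf (op : OpCode) (ws : List (List ℕ)) : List (List (List ℕ)) :=
  op.elim [ws] fun o =>
    if o.1 = true then [ws.set o.2.1 (ws.getD o.2.1 [] ++ [o.2.2])]
    else if (ws.getD o.2.1 []).head? = some o.2.2 then [ws.set o.2.1 (ws.getD o.2.1 []).tail]
    else []

open Classical in
/-- The successors of `s` by the rule `r`. -/
noncomputable def ruleSuccs (r : RuleCode) (s : ConfCode) : List ConfCode :=
  if r.1 = s.1 ∧ Mem r.2.1 s then
    (perf r.2.2.1 s.2).flatMap fun ws =>
      (ws.map List.sublists').sections.map fun us => (r.2.2.2, us)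
  else []

/-- The successors of `s` in the game `g`. -/
noncomputable def succs (g : GameCode) (s : ConfCode) : List ConfCode :=
  g.2.2.flatMap fun r => ruleSuccs r s

/-- It is the turn of `P` in `s`. -/
def Owns (P : Player) (g : GameCode) (s : ConfCode) : Prop := s.1 ∈ g.2.1 ↔ P = .A

/-- The controllable predecessor on codes. -/
def CPre (P : Player) (g : GameCode) (X : ConfCode → Prop) (s : ConfCode) : Prop :=
  (Owns P g s ∧ ∃ t ∈ succs g s, X t) ∨ (¬ Owns P g s ∧ ∀ t ∈ succs g s, X t)

/-- The operator `SymGame.stepOp` on codes. -/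
def StepOp (P : Player) (buchi : Bool) (g : GameCode) (V Y X : ConfCode → Prop) (s : ConfCode) :
    Prop :=
  (V s ∧ (buchi = true → (Owns P g s ∧ CPre P g (CPre P g Y) s) ∨ (¬ Owns P g s ∧ CPre P g Y s))) ∨
    CPre P g X s

/-- Membership in a region or, if `f = false`, in its complement. -/
def FMem (f : Bool) (R : RegionCode) (s : ConfCode) : Prop := Mem R s ↔ f = true

/-- Codes of certificates: the approximants `X` and `Y` and the numbers of steps. -/
abbrev CertCode := (List RegionCode × List RegionCode) × ℕ × ℕ

/-- The approximants `X` of a certificate. -/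
def CertCode.X (c : CertCode) (i : ℕ) : RegionCode := c.1.1.getD i []

/-- The approximants `Y` of a certificate. -/
def CertCode.Y (c : CertCode) (i : ℕ) : RegionCode := c.1.2.getD i []

/-- The conditions on a certificate hold at `s`. -/
def CheckAt (P : Player) (buchi f : Bool) (g : GameCode) (v : RegionCode) (c : CertCode)
    (s : ConfCode) : Prop :=
  (¬ FMem f (c.X 0) s ∧
    (∀ i < c.2.1, FMem f (c.X (i + 1)) s →
      StepOp P buchi g (FMem f v) (FMem f (c.Y c.2.2)) (FMem f (c.X i)) s)) ∧
    (FMem f (c.Y c.2.2) s → FMem f (c.X c.2.1) s) ∧ FMem f (c.Y 0) s ∧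
    ∀ j < c.2.2, StepOp P buchi g (FMem f v) (FMem f (c.Y j)) (FMem f (c.Y (j + 1))) s →
      FMem f (c.Y (j + 1)) s

/-- The words over `0, …, m - 1` that are shorter than `N`. -/
def words (m N : ℕ) : List (List ℕ) :=
  (List.range N).flatMap fun k => (List.replicate k (List.range m)).sections

/-- The configurations of `g` with channel contents shorter than `N`. -/
def confs (g : GameCode) (N : ℕ) : List ConfCode :=
  (List.range g.1.1).flatMap fun q =>
    (List.replicate g.1.2.1 (words g.1.2.2 N)).sections.map fun ws => (q, ws)

theorem mem_sections_replicate {α : Type*} {l t : List α} {k : ℕ} :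
    t ∈ (List.replicate k l).sections ↔ t.length = k ∧ ∀ x ∈ t, x ∈ l := by
  induction k generalizing t with
  | zero => cases t <;> simp
  | succ k ih =>
    rw [List.mem_sections, List.replicate_succ, List.forall₂_cons_right_iff]
    simp only [← List.mem_sections, ih]
    cases t with
    | nil => simp
    | cons a t => simp; tauto

theorem mem_words {m N : ℕ} {t : List ℕ} : t ∈ words m N ↔ t.length < N ∧ ∀ x ∈ t, x < m := by
  simp [words, mem_sections_replicate]

theorem mem_confs {g : GameCode} {N : ℕ} {s : ConfCode} :
    s ∈ confs g N ↔ s.1 < g.1.1 ∧ s.2.length = g.1.2.1 ∧ ∀ w ∈ s.2, w.length < N ∧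
      ∀ x ∈ w, x < g.1.2.2 := by
  obtain ⟨q, ws⟩ := s
  simp only [confs, List.mem_flatMap, List.mem_range, List.mem_map, Prod.mk.injEq,
    mem_sections_replicate, mem_words]
  constructor
  · rintro ⟨q', h1, ws', h2, rfl, rfl⟩
    exact ⟨h1, h2⟩
  · rintro ⟨h1, h2⟩
    exact ⟨q, h1, ws, h2, rfl, rfl⟩

/-! ### Agreement of coded and actual games -/

section Adequacy

variable {Q C M : Type*} (num : Numbering Q C M)

/-- The code of a word. -/
def word (w : List M) : List ℕ := w.map fun m => (num.msg m : ℕ)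

/-- The code of the contents of all channels. -/
def contents (w : C → List M) : List (List ℕ) :=
  List.ofFn fun j : Fin num.nC => word num (w (num.chan.symm j))

theorem word_injective : Function.Injective (word num) :=
  List.map_injective_iff.2 fun _ _ h => num.msg.injective (Fin.ext h)

theorem exists_word {t : List ℕ} (h : ∀ x ∈ t, x < num.nM) : ∃ w, word num w = t := by
  induction t with
  | nil => exact ⟨[], rfl⟩
  | cons a t ih =>
    obtain ⟨w, rfl⟩ := ih fun x hx => h x (.tail _ hx)
    exact ⟨num.msg.symm ⟨a, h a (.head _)⟩ :: w, by simp [word]⟩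

theorem confCode_eq (σ : Conf Q C M) :
    confCode num σ = ((num.loc σ.1 : ℕ), contents num σ.2) := rfl

@[simp]
theorem length_contents (w : C → List M) : (contents num w).length = num.nC := by simp [contents]

theorem contents_getD (w : C → List M) (c : C) :
    (contents num w).getD (num.chan c) [] = word num (w c) := by
  simp [contents, List.getD]

theorem eq_contents_iff (ws : List (List ℕ)) (w : C → List M) :
    ws = contents num w ↔ ws.length = num.nC ∧ ∀ c, ws.getD (num.chan c) [] = word num (w c) := by
  constructor
  · rintro rfl
    exact ⟨length_contents num w, contents_getD num w⟩
  · rintro ⟨h1, h2⟩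
    refine List.ext_getElem (by simp [h1]) fun j hj hj' => ?_
    have h3 := h2 (num.chan.symm ⟨j, h1 ▸ hj⟩)
    rw [← contents_getD] at h3
    simp only [Equiv.apply_symm_apply] at h3
    rwa [List.getD_eq_getElem _ _ hj, List.getD_eq_getElem _ _ hj'] at h3

theorem contents_injective : Function.Injective (contents (C := C) num) := by
  intro w w' h
  funext c
  apply word_injective num
  rw [← contents_getD, h, contents_getD]

theorem exists_contents {ws : List (List ℕ)} (h : ws.length = num.nC)
    (h' : ∀ w ∈ ws, ∀ x ∈ w, x < num.nM) : ∃ w : C → List M, contents num w = ws := by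
  have : ∀ c : C, ∃ w, word num w = ws.getD (num.chan c) [] := fun c => by
    apply exists_word
    have hc : (num.chan c : ℕ) < ws.length := by rw [h]; exact (num.chan c).2
    rw [List.getD_eq_getElem _ _ hc]
    exact h' _ (List.getElem_mem _)
  choose w hw using this
  exact ⟨w, ((eq_contents_iff num ws w).2 ⟨h, fun c => (hw c).symm⟩).symm⟩

theorem mem_iff (R : RegionCode) (σ : Conf Q C M) :
    Mem R (confCode num σ) ↔ σ ∈ RegionCode.denote num R := by
  rw [confCode_eq]
  refine exists_congr fun r => and_congr_right fun _ => and_congr_right fun _ => ?_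
  simp only [length_contents]
  constructor
  · intro h c
    have h1 := h (num.chan c) (num.chan c).2
    rw [contents_getD, accepts_iff] at h1
    cases h2 : r.2[(num.chan c : ℕ)]? with
    -- The default automaton of `Mem` has no accepting state, so a missing entry rejects, as
    -- `denote` demands.
    | none =>
      rw [List.getD, h2, ← accepts_iff] at h1
      obtain ⟨s, -, h3⟩ := h1
      simp at h3
    | some a =>
      rw [List.getD, h2] at h1
      exact ⟨a, rfl, h1⟩
  · intro h j hj
    obtain ⟨a, h1, h2⟩ := h (num.chan.symm ⟨j, hj⟩)
    have h3 := contents_getD num σ.2 (num.chan.symm ⟨j, hj⟩)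
    simp only [Equiv.apply_symm_apply] at h1 h3
    rw [h3, accepts_iff, List.getD, h1]
    exact h2

/-- Message losses act on the channels independently, so lossy results are choices of one subword
per channel. -/
theorem mem_sections_sublists' (u : C → List M) (vs : List (List ℕ)) :
    vs ∈ ((contents num u).map List.sublists').sections ↔
      ∃ v : C → List M, (∀ c, (v c).Sublist (u c)) ∧ contents num v = vs := by
  rw [List.mem_sections, List.forall₂_iff_get]
  simp only [List.length_map, length_contents, List.get_eq_getElem, List.getElem_map,
    List.mem_sublists']
  constructor
  · rintro ⟨h1, h2⟩
    have : ∀ c : C, ∃ v, v.Sublist (u c) ∧ word num v = vs.getD (num.chan c) [] := fun c => by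
      have h3 := h2 (num.chan c) (by rw [h1]; exact (num.chan c).2) (num.chan c).2
      rw [← List.getD_eq_getElem _ [], ← List.getD_eq_getElem _ [], contents_getD, word,
        List.sublist_map_iff] at h3
      obtain ⟨v, h4, h5⟩ := h3
      exact ⟨v, h4, h5.symm⟩
    choose v hv hv' using this
    exact ⟨v, hv, ((eq_contents_iff num vs v).2 ⟨h1, fun c => (hv' c).symm⟩).symm⟩
  · rintro ⟨v, hv, rfl⟩
    refine ⟨length_contents num v, fun j h1 h2 => ?_⟩
    simpa [contents, word] using (hv (num.chan.symm ⟨j, h2⟩)).map fun m => (num.msg m : ℕ)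

theorem set_contents [DecidableEq C] (w : C → List M) (c : C) (x : List M) :
    (contents num w).set (num.chan c) (word num x) = contents num (Function.update w c x) := by
  rw [eq_contents_iff]
  refine ⟨by simp, fun d => ?_⟩
  rcases eq_or_ne d c with rfl | hd
  · simp [List.getD]
  · have : (num.chan c : ℕ) ≠ num.chan d := fun h => hd (num.chan.injective (Fin.ext h.symm))
    rw [List.getD, List.getElem?_set_ne this, ← List.getD, contents_getD, Function.update_of_ne hd]

theorem mem_perf (op : Op C M) (w : C → List M) (us : List (List ℕ)) :
    us ∈ perf (opCode num op) (contents num w) ↔ ∃ u, op.Effect w u ∧ contents num u = us := by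
  classical
  have hupd : ∀ (c : C) (x : List M) (u : C → List M),
      (u c = x ∧ ∀ d, d ≠ c → u d = w d) ↔ u = Function.update w c x := fun c x u =>
    (Function.eq_update_iff).symm
  cases op with
  | send c m =>
    have : word num (w c) ++ [(num.msg m : ℕ)] = word num (w c ++ [m]) := by simp [word]
    simp only [perf, opCode, Option.elim, if_true, contents_getD, this, set_contents,
      List.mem_singleton, Op.Effect, hupd, exists_eq_left]
    exact eq_comm
  | recv c m =>
    simp only [perf, opCode, Option.elim, contents_getD, Bool.false_eq_true, if_false]
    split_ifs with h
    · obtain ⟨t, ht⟩ : ∃ t, w c = m :: t := by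
        cases hw : w c with
        | nil => simp [hw, word] at h
        | cons a t =>
          simp only [hw, word, List.map_cons, List.head?_cons, Option.some.injEq] at h
          exact ⟨t, by rw [num.msg.injective (Fin.ext h)]⟩
      have h1 : (word num (w c)).tail = word num t := by simp [ht, word]
      have h2 : ∀ u : C → List M, (Op.recv c m).Effect w u ↔ u = Function.update w c t := fun u => by
        rw [← hupd, Op.Effect, ht]
        simp [eq_comm]
      simp only [h1, set_contents, List.mem_singleton, h2, exists_eq_left]
      exact eq_comm
    · simp only [List.not_mem_nil, false_iff]
      rintro ⟨u, ⟨h1, -⟩, -⟩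
      exact h (by simp [h1, word])
  | internal =>
    simp only [perf, opCode, Option.elim, List.mem_singleton, Op.Effect, exists_eq_left]
    exact eq_comm

variable {num}

theorem mem_ruleSuccs {r : RuleCode} {δ : Rule Q C M} (hr : RuleCode.Encodes num r δ)
    (σ : Conf Q C M) (t : ConfCode) :
    t ∈ ruleSuccs r (confCode num σ) ↔ ∃ ρ, δ.Step σ ρ ∧ confCode num ρ = t := by
  obtain ⟨h1, h2, h3, h4⟩ := hr
  have hloc : r.1 = (confCode num σ).1 ↔ σ.1 = δ.src := by
    rw [h1, confCode_eq, ← Fin.ext_iff, num.loc.injective.eq_iff, eq_comm]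
  rw [ruleSuccs]
  split_ifs with h
  · rw [hloc, mem_iff, h2] at h
    simp only [List.mem_flatMap, List.mem_map, h3, confCode_eq num σ, mem_perf, h4]
    constructor
    · rintro ⟨_, ⟨u, h5, rfl⟩, vs, h6, rfl⟩
      rw [mem_sections_sublists'] at h6
      obtain ⟨v, h7, rfl⟩ := h6
      exact ⟨(δ.tgt, v), ⟨(δ.tgt, u), ⟨h.2, h.1, rfl, h5⟩, rfl, h7⟩, rfl⟩
    · rintro ⟨⟨q, v⟩, ⟨⟨p, u⟩, ⟨-, -, h5, h6⟩, h7, h8⟩, rfl⟩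
      refine ⟨_, ⟨u, h6, rfl⟩, contents num v, (mem_sections_sublists' num u _).2 ⟨v, h8, rfl⟩, ?_⟩
      rw [confCode_eq]
      simp only at h5 h7
      rw [h7, h5]
  · simp only [List.not_mem_nil, false_iff]
    rintro ⟨ρ, ⟨σ', ⟨h5, h6, -⟩, -⟩, -⟩
    exact h ⟨hloc.2 h6, (mem_iff num _ _).2 (h2 ▸ h5)⟩

variable {g : GameCode} {L : SymGame Q C M} (hg : GameCode.Encodes num g L)

include hg

theorem mem_succs (σ : Conf Q C M) (t : ConfCode) :
    t ∈ succs g (confCode num σ) ↔ ∃ ρ, L.Step σ ρ ∧ confCode num ρ = t := by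
  simp only [succs, List.mem_flatMap]
  constructor
  · rintro ⟨r, hr, ht⟩
    obtain ⟨δ, hδ, he⟩ := hg.2.2.1 r hr
    obtain ⟨ρ, h1, h2⟩ := (mem_ruleSuccs he σ t).1 ht
    exact ⟨ρ, ⟨δ, hδ, h1⟩, h2⟩
  · rintro ⟨ρ, ⟨δ, hδ, h1⟩, h2⟩
    obtain ⟨r, hr, he⟩ := hg.2.2.2 δ hδ
    exact ⟨r, hr, (mem_ruleSuccs he σ t).2 ⟨ρ, h1, h2⟩⟩

theorem owns_iff (P : Player) (σ : Conf Q C M) :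
    Owns P g (confCode num σ) ↔ L.owner σ.1 = P := by
  rw [Owns, confCode_eq, hg.2.1]
  cases L.owner σ.1 <;> cases P <;> simp

theorem cPre_iff (P : Player) {Xc : ConfCode → Prop} {X : Set (Conf Q C M)}
    (hX : ∀ σ, Xc (confCode num σ) ↔ σ ∈ X) (σ : Conf Q C M) :
    CPre P g Xc (confCode num σ) ↔ σ ∈ L.cpre P X := by
  have h1 : ¬ L.owner σ.1 = P ↔ L.owner σ.1 = P.opponent :=
    ⟨(P.eq_or_eq_opponent _).resolve_left, fun h h' => P.opponent_ne (h.symm.trans h')⟩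
  rw [CPre, owns_iff hg, h1]
  refine or_congr (and_congr_right fun _ => ?_) (and_congr_right fun _ => ?_)
  · simp only [mem_succs hg]
    constructor
    · rintro ⟨_, ⟨ρ, h2, rfl⟩, h3⟩
      exact ⟨ρ, h2, (hX ρ).1 h3⟩
    · rintro ⟨ρ, h2, h3⟩
      exact ⟨_, ⟨ρ, h2, rfl⟩, (hX ρ).2 h3⟩
  · simp only [mem_succs hg]
    constructor
    · exact fun h ρ hρ => (hX ρ).1 (h _ ⟨ρ, hρ, rfl⟩)
    · rintro h _ ⟨ρ, hρ, rfl⟩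
      exact (hX ρ).2 (h ρ hρ)

theorem stepOp_iff (P : Player) (buchi : Bool) {Vc Yc Xc : ConfCode → Prop}
    {V Y X : Set (Conf Q C M)} (hV : ∀ σ, Vc (confCode num σ) ↔ σ ∈ V)
    (hY : ∀ σ, Yc (confCode num σ) ↔ σ ∈ Y) (hX : ∀ σ, Xc (confCode num σ) ↔ σ ∈ X)
    (σ : Conf Q C M) :
    StepOp P buchi g Vc Yc Xc (confCode num σ) ↔ σ ∈ L.stepOp P buchi V Y X := by
  have h1 : ¬ L.owner σ.1 = P ↔ L.owner σ.1 = P.opponent :=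
    ⟨(P.eq_or_eq_opponent _).resolve_left, fun h h' => P.opponent_ne (h.symm.trans h')⟩
  rw [StepOp, owns_iff hg, h1, hV, cPre_iff hg P hX, cPre_iff hg P hY,
    cPre_iff hg P (cPre_iff hg P hY)]
  rfl

omit hg in
variable (num) in
/-- The region with code `R` or, if `f = false`, its complement. -/
def flagSet (f : Bool) (R : RegionCode) : Set (Conf Q C M) :=
  {σ | σ ∈ RegionCode.denote num R ↔ f = true}

omit hg in
theorem fMem_iff (f : Bool) (R : RegionCode) (σ : Conf Q C M) :
    FMem f R (confCode num σ) ↔ σ ∈ flagSet num f R := by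
  rw [FMem, mem_iff]
  rfl

/-- Every condition of a certificate is pointwise in the configuration, so the whole of it becomes
one predicate to be tested everywhere. -/
theorem certifies_iff (P : Player) (buchi f : Bool) (v : RegionCode) (c : CertCode) :
    L.Certifies P buchi (flagSet num f v) (fun i => flagSet num f (c.X i))
      (fun j => flagSet num f (c.Y j)) c.2.1 c.2.2 ↔
      ∀ σ : Conf Q C M, CheckAt P buchi f g v c (confCode num σ) := by
  simp only [CheckAt, fMem_iff, stepOp_iff hg P buchi (fMem_iff f _) (fMem_iff f _) (fMem_iff f _)]
  constructor
  · exact fun h σ => ⟨⟨fun h0 => (h.X_zero ▸ h0 : σ ∈ (∅ : Set _)), fun i hi h1 => h.X_succ i hi h1⟩,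
      fun h1 => h.subset_X h1, h.Y_zero ▸ Set.mem_univ σ, fun j hj h1 => h.Y_succ j hj h1⟩
  · intro h
    exact ⟨Set.eq_empty_iff_forall_notMem.2 fun σ => (h σ).1.1, fun i hi σ => (h σ).1.2 i hi,
      fun σ => (h σ).2.1, Set.eq_univ_iff_forall.2 fun σ => (h σ).2.2.1,
      fun j hj σ => (h σ).2.2.2 j hj⟩

omit hg

/-! ### Small configurations suffice -/

/-- The numerical code serves as a size: parts have codes no larger than the whole, so one number
bounds all automata in an input and all their states. -/
theorem encode_le_of_mem {α : Type*} [Encodable α] {a : α} {l : List α} (h : a ∈ l) :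
    Encodable.encode a ≤ Encodable.encode l := by
  induction l with
  | nil => simp at h
  | cons b l ih =>
    rw [Encodable.encode_list_cons]
    rcases List.mem_cons.1 h with rfl | h
    · exact (Nat.left_le_pair _ _).trans (Nat.le_succ _)
    · exact ((ih h).trans (Nat.right_le_pair _ _)).trans (Nat.le_succ _)

theorem encode_fst_le {α β : Type*} [Encodable α] [Encodable β] (p : α × β) :
    Encodable.encode p.1 ≤ Encodable.encode p := Nat.left_le_pair _ _

theorem encode_snd_le {α β : Type*} [Encodable α] [Encodable β] (p : α × β) :
    Encodable.encode p.2 ≤ Encodable.encode p := Nat.right_le_pair _ _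

theorem encode_getD_le {α : Type*} [Encodable α] (l : List (List α)) (i : ℕ) :
    Encodable.encode (l.getD i []) ≤ Encodable.encode l := by
  by_cases h : i < l.length
  · rw [List.getD_eq_getElem _ _ h]
    exact encode_le_of_mem (List.getElem_mem h)
  · rw [List.getD_eq_default _ _ (not_lt.1 h)]
    exact Nat.zero_le _

theorem le_encode_of_mem_eval {a : AutCode} {w : List ℕ} {s : ℕ} (h : s ∈ a.toNFA.eval w) :
    s ≤ Encodable.encode a := by
  induction w using List.reverseRecOn with
  | nil =>
    have : s ∈ a.1 := h
    exact (encode_le_of_mem this).trans (encode_fst_le a)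
  | append_singleton w m ih =>
    rw [NFA.eval_append_singleton, NFA.mem_stepSet] at h
    obtain ⟨t, -, ht⟩ := h
    have : (t, m, s) ∈ a.2.1 := ht
    exact ((encode_snd_le _).trans (encode_snd_le _)).trans <|
      ((encode_le_of_mem this).trans (encode_fst_le a.2)).trans (encode_snd_le a)

variable (num) in
/-- The behaviour of all automata with codes below `e` on a word. -/
def behaviour (e : ℕ) (w : List M) : Set (Fin e × Fin e) :=
  {p | ∃ a : AutCode, Encodable.encode a = p.1 ∧ (p.2 : ℕ) ∈ a.toNFA.eval (word num w)}

theorem eval_subset_of_behaviour_eq {e : ℕ} {w w' : List M}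
    (h : behaviour num e w = behaviour num e w') {a : AutCode} (ha : Encodable.encode a < e) :
    a.toNFA.eval (word num w) ⊆ a.toNFA.eval (word num w') := by
  intro s hs
  have h1 : ((⟨_, ha⟩, ⟨s, (le_encode_of_mem_eval hs).trans_lt ha⟩) : Fin e × Fin e) ∈
      behaviour num e w := ⟨a, rfl, hs⟩
  rw [h] at h1
  obtain ⟨a', h2, h3⟩ := h1
  obtain rfl := Encodable.encode_injective h2
  exact h3

/-- The states reached after one more letter depend only on those reached before. Cutting off at `e`
loses nothing, since an automaton with code below `e` reaches only states below `e`. -/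
theorem isRightCongruence_behaviour (e : ℕ) :
    IsRightCongruence (behaviour (C := C) (Q := Q) num e) := by
  have key : ∀ w w' m, behaviour num e w = behaviour num e w' →
      behaviour num e (w ++ [m]) ⊆ behaviour num e (w' ++ [m]) := by
    rintro w w' m h ⟨i, j⟩ ⟨a, h1, h2⟩
    refine ⟨a, h1, ?_⟩
    have h3 : ∀ w : List M, word num (w ++ [m]) = word num w ++ [(num.msg m : ℕ)] := fun w => by
      simp [word]
    rw [h3, NFA.eval_append_singleton, NFA.mem_stepSet] at h2 ⊢
    obtain ⟨t, h4, h5⟩ := h2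
    exact ⟨t, eval_subset_of_behaviour_eq h (h1.trans_lt i.2) h4, h5⟩
  exact fun w w' m h => (key w w' m h).antisymm (key w' w m h.symm)

theorem respects_denote {e : ℕ} {R : RegionCode} (hR : Encodable.encode R < e) :
    Respects (behaviour num e) (RegionCode.denote num R : Set (Conf Q C M)) := by
  rintro q w w' h ⟨r, hr, h1, h2⟩
  refine ⟨r, hr, h1, fun c => ?_⟩
  obtain ⟨a, h3, s, h4, h5⟩ := h2 c
  have h6 : Encodable.encode a < e := lt_of_le_of_lt (((encode_le_of_mem
    (List.mem_of_getElem? h3)).trans (encode_snd_le r)).trans (encode_le_of_mem hr)) hR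
  exact ⟨a, h3, s, h4, eval_subset_of_behaviour_eq (h c) h6 h5⟩

theorem respects_flagSet (f : Bool) {e : ℕ} {R : RegionCode} (hR : Encodable.encode R < e) :
    Respects (behaviour num e) (flagSet num f R : Set (Conf Q C M)) := by
  cases f with
  | true => simpa [flagSet] using respects_denote hR
  | false =>
    have : (flagSet num false R : Set (Conf Q C M)) = (RegionCode.denote num R)ᶜ := by
      ext; simp [flagSet]
    rw [this]
    exact (respects_denote hR).compl

/-- The number of classes of `refine f`, if `f` has `s` classes and there are `m` messages. -/
def refineCard (m s : ℕ) : ℕ := s * (2 ^ s * ((m + 1) * 2 ^ s))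

/-- A length of words that suffices to test the certificate `c`. -/
def bound (g : GameCode) (v : RegionCode) (c : CertCode) : ℕ :=
  let e := Encodable.encode (g, v, c) + 1
  refineCard g.1.2.2 (refineCard g.1.2.2 (2 ^ (e * e)))

variable (num) in
theorem card_refine {S : Type*} [Finite S] :
    Nat.card (S × Set S × Option M × Set S) = refineCard num.nM (Nat.card S) := by
  have : Finite M := Finite.of_equiv _ num.msg.symm
  have h1 : Nat.card M = num.nM := by rw [Nat.card_congr num.msg, Nat.card_fin]
  have h2 : Nat.card (Set S) = 2 ^ Nat.card S := by
    have := Fintype.ofFinite S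
    classical
    rw [Nat.card_eq_fintype_card, Nat.card_eq_fintype_card, Fintype.card_set]
  rw [Nat.card_prod, Nat.card_prod, Nat.card_prod, Finite.card_option, h1, h2, refineCard]

include hg in
-- The guards, `v` and all regions of `c` have codes below `e`, so the behaviour congruence
-- saturates them all, and its second refinement also saturates the values of `stepOp`. The test is
-- a Boolean combination of such sets.
theorem respects_checkAt (P : Player) (buchi f : Bool) (v : RegionCode) (c : CertCode) :
    Respects (refine (refine (behaviour num (Encodable.encode (g, v, c) + 1))))
      {σ : Conf Q C M | CheckAt P buchi f g v c (confCode num σ)} := by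
  set e := Encodable.encode (g, v, c) + 1 with he
  have hf := isRightCongruence_behaviour (num := num) e
  have hc : Encodable.encode c < e :=
    Nat.lt_succ_of_le ((encode_snd_le (v, c)).trans (encode_snd_le (g, v, c)))
  have hv : Encodable.encode v < e :=
    Nat.lt_succ_of_le ((encode_fst_le (v, c)).trans (encode_snd_le (g, v, c)))
  have hX : ∀ i, Encodable.encode (c.X i) < e := fun i =>
    ((encode_getD_le _ i).trans ((encode_fst_le c.1).trans (encode_fst_le c))).trans_lt hc
  have hY : ∀ i, Encodable.encode (c.Y i) < e := fun i =>
    ((encode_getD_le _ i).trans ((encode_snd_le c.1).trans (encode_fst_le c))).trans_lt hc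
  have hG : ∀ δ ∈ L.rules, Respects (behaviour num e) δ.guard := by
    intro δ hδ
    obtain ⟨r, hr, -, h1, -⟩ := hg.2.2.2 δ hδ
    rw [← h1]
    apply respects_denote
    have h2 : Encodable.encode r.2.1 ≤ Encodable.encode r :=
      (encode_fst_le r.2).trans (encode_snd_le r)
    refine Nat.lt_succ_of_le (h2.trans ((encode_le_of_mem hr).trans ?_))
    exact ((encode_snd_le g.2).trans (encode_snd_le g)).trans (encode_fst_le (g, v, c))
  have hS : ∀ Y X : RegionCode, Encodable.encode Y < e → Encodable.encode X < e →
      Respects (refine (refine (behaviour num e)))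
        (L.stepOp P buchi (flagSet num f v) (flagSet num f Y) (flagSet num f X)) :=
    fun Y X h1 h2 => Respects.stepOp hf hG P buchi (respects_flagSet f hv) (respects_flagSet f h1)
      (respects_flagSet f h2)
  have hM : ∀ X : RegionCode, Encodable.encode X < e →
      Respects (refine (refine (behaviour num e))) (flagSet num f X : Set (Conf Q C M)) :=
    fun X h1 => (respects_flagSet f h1).refine.refine
  intro q w w' h
  have h' := fun c => (h c).symm
  simp only [Set.mem_ofPred_eq, CheckAt, fMem_iff,
    stepOp_iff hg P buchi (fMem_iff f _) (fMem_iff f _) (fMem_iff f _)]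
  rintro ⟨⟨h1, h2⟩, h3, h4, h5⟩
  exact ⟨⟨fun h6 => h1 (hM _ (hX 0) q w' w h' h6), fun i hi h6 => hS _ _ (hY _) (hX i) q w w' h
      (h2 i hi (hM _ (hX _) q w' w h' h6))⟩,
    fun h6 => hM _ (hX _) q w w' h (h3 (hM _ (hY _) q w' w h' h6)), hM _ (hY 0) q w w' h h4,
    fun j hj h6 => hM _ (hY _) q w w' h (h5 j hj (hS _ _ (hY j) (hY _) q w' w h' h6))⟩

/-- The test of a certificate on all small configurations. -/
def Check (P : Player) (buchi f : Bool) (g : GameCode) (v : RegionCode) (c : CertCode) : Prop :=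
  ∀ s ∈ confs g (bound g v c), CheckAt P buchi f g v c s

include hg in
-- Every configuration is equivalent to one with short channel contents, where the test gives the
-- same answer.
theorem check_iff (P : Player) (buchi f : Bool) (v : RegionCode) (c : CertCode) :
    Check P buchi f g v c ↔
      L.Certifies P buchi (flagSet num f v) (fun i => flagSet num f (c.X i))
        (fun j => flagSet num f (c.Y j)) c.2.1 c.2.2 := by
  rw [certifies_iff hg]
  have hn : g.1 = (num.nQ, num.nC, num.nM) := hg.1
  constructor
  · rintro h ⟨q, w⟩
    have : Finite M := Finite.of_equiv _ num.msg.symm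
    have hf := (isRightCongruence_behaviour (num := num)
      (Encodable.encode (g, v, c) + 1)).refine.refine
    -- The words `u` are shorter than the number of possible classes, which is exactly `bound`: `2 ^
    -- (e * e)` behaviours, refined twice.
    choose u hu hu' using fun d => hf.exists_short (w d)
    refine respects_checkAt hg P buchi f v c q u w hu (h _ (mem_confs.2 ?_))
    rw [hn, confCode_eq]
    refine ⟨(num.loc q).2, length_contents num u, fun t ht => ?_⟩
    obtain ⟨j, rfl⟩ := List.mem_ofFn.1 ht
    refine ⟨?_, ?_⟩
    · have h1 := hu' (num.chan.symm j)
      rw [card_refine num, card_refine num] at h1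
      have h2 : ∀ e, Nat.card (Set (Fin e × Fin e)) = 2 ^ (e * e) := fun e => by
        rw [Nat.card_eq_fintype_card, Fintype.card_set, Fintype.card_prod, Fintype.card_fin]
      rw [h2] at h1
      simp only [word, List.length_map, bound, hn]
      exact h1
    · intro x hx
      obtain ⟨m, -, rfl⟩ := List.mem_map.1 hx
      exact (num.msg m).2
  · intro h s hs
    rw [mem_confs, hn] at hs
    obtain ⟨w, hw⟩ := exists_contents num hs.2.1 fun t ht => (hs.2.2 t ht).2
    have := h (num.loc.symm ⟨s.1, hs.1⟩, w)
    rw [confCode_eq, hw] at this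
    simpa using this

end Adequacy
end Code
/-! ### Primitive recursiveness of the test -/

set_option synthInstance.maxSize 1000

section Primrec

variable {α β γ : Type*} [Primcodable α] [Primcodable β] [Primcodable γ]

theorem primrecPred_exists_mem {l : α → List β} {R : α → β → Prop} (hl : Primrec l)
    (hR : PrimrecPred fun p : α × β => R p.1 p.2) : PrimrecPred fun a => ∃ b ∈ l a, R a b :=
  (PrimrecRel.exists_mem_list (R := fun b a => R a b)
    (hR.comp (Primrec.pair Primrec.snd Primrec.fst))).comp hl Primrec.id

theorem primrecPred_forall_mem {l : α → List β} {R : α → β → Prop} (hl : Primrec l)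
    (hR : PrimrecPred fun p : α × β => R p.1 p.2) : PrimrecPred fun a => ∀ b ∈ l a, R a b :=
  (PrimrecRel.forall_mem_list (R := fun b a => R a b)
    (hR.comp (Primrec.pair Primrec.snd Primrec.fst))).comp hl Primrec.id

theorem primrecPred_forall_lt {l : α → ℕ} {R : α → ℕ → Prop} (hl : Primrec l)
    (hR : PrimrecPred fun p : α × ℕ => R p.1 p.2) : PrimrecPred fun a => ∀ b < l a, R a b :=
  (primrecPred_forall_mem (Primrec.list_range.comp hl) hR).of_eq fun a => by simp

theorem primrecPred_imp {p q : α → Prop} (hp : PrimrecPred p) (hq : PrimrecPred q) :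
    PrimrecPred fun a => p a → q a :=
  (hp.not.or hq).of_eq fun _ => imp_iff_not_or.symm

theorem primrecPred_iff {p q : α → Prop} (hp : PrimrecPred p) (hq : PrimrecPred q) :
    PrimrecPred fun a => (p a ↔ q a) :=
  ((primrecPred_imp hp hq).and (primrecPred_imp hq hp)).of_eq fun _ => iff_def.symm

theorem primrecPred_const (p : Prop) : PrimrecPred fun _ : α => p := by
  by_cases h : p
  · exact (Primrec.eq.comp (Primrec.const 0) (Primrec.const 0)).of_eq fun _ => by simp [h]
  · exact (Primrec.eq.comp (Primrec.const 0) (Primrec.const 1)).of_eq fun _ => by simp [h]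

theorem primrecPred_mem {f : α → β} {l : α → List β} (hf : Primrec f) (hl : Primrec l) :
    PrimrecPred fun a => f a ∈ l a :=
  (primrecPred_exists_mem (R := fun a b => b = f a) hl
    (Primrec.eq.comp Primrec.snd (hf.comp Primrec.fst))).of_eq fun a => by simp

theorem primrec_sections : Primrec (List.sections : List (List α) → List (List α)) := by
  have : Primrec fun L : List (List α) => L.foldr
      (fun l acc => acc.flatMap fun s => l.map fun a => a :: s) [[]] := by
    refine Primrec.list_foldr (h := fun _ (p : List α × List (List α)) =>
        p.2.flatMap fun s => p.1.map fun a => a :: s)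
      Primrec.id (Primrec.const _) ?_
    refine Primrec.list_flatMap (g := fun (p : List (List α) × List α × List (List α)) (s : List α) =>
      p.2.1.map fun a => a :: s)
      (Primrec.snd.comp Primrec.snd) ?_
    refine Primrec.list_map
      (g := fun (p : (List (List α) × List α × List (List α)) × List α) (a : α) => a :: p.2)
      (Primrec.fst.comp (Primrec.snd.comp Primrec.fst)) ?_
    exact Primrec.list_cons.comp Primrec.snd (Primrec.snd.comp Primrec.fst)
  refine this.of_eq fun L => ?_
  induction L with
  | nil => rfl
  | cons l L ih => rw [List.foldr_cons, ih, List.sections]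

theorem primrec_sublists' : Primrec (List.sublists' : List α → List (List α)) := by
  have : Primrec fun l : List α => l.foldr
      (fun a acc => acc ++ acc.map fun s => a :: s) [[]] := by
    refine Primrec.list_foldr
      (h := fun _ (p : α × List (List α)) => p.2 ++ p.2.map fun s => p.1 :: s)
      Primrec.id (Primrec.const _) ?_
    refine Primrec.list_append.comp (Primrec.snd.comp Primrec.snd) ?_
    refine Primrec.list_map (g := fun (p : List α × α × List (List α)) (s : List α) => p.2.1 :: s)
      (Primrec.snd.comp Primrec.snd) ?_
    exact Primrec.list_cons.comp (Primrec.fst.comp (Primrec.snd.comp Primrec.fst)) Primrec.snd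
  refine this.of_eq fun l => ?_
  induction l with
  | nil => rfl
  | cons a l ih => rw [List.foldr_cons, ih, List.sublists'_cons]

theorem primrec_replicate : Primrec fun p : ℕ × α => List.replicate p.1 p.2 :=
  (Primrec.list_map (f := fun p : ℕ × α => List.range p.1) (g := fun p _ => p.2)
    (Primrec.list_range.comp Primrec.fst) (Primrec.snd.comp Primrec.fst)).of_eq fun p => by simp

theorem primrec_pow : Primrec₂ ((· ^ ·) : ℕ → ℕ → ℕ) := Primrec₂.unpaired'.1 Nat.Primrec.pow

end Primrec

/-! ### Primitive recursive game operations -/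

namespace Code

open Primrec (fst snd)

theorem primrec_run : Primrec₂ run := by
  classical
  refine Primrec.list_foldl (h := fun (p : AutCode × List ℕ) (q : List ℕ × ℕ) =>
    (p.1.2.1.filter fun t => t.1 ∈ q.1 ∧ t.2.1 = q.2).map fun t => t.2.2) snd (fst.comp fst) ?_
  refine Primrec.list_map (g := fun _ t => t.2.2) (f := fun q : (AutCode × List ℕ) × List ℕ × ℕ =>
    q.1.1.2.1.filter fun t => t.1 ∈ q.2.1 ∧ t.2.1 = q.2.2) ?_
    (snd.comp (snd.comp snd))
  have : PrimrecRel fun (t : ℕ × ℕ × ℕ) (q : List ℕ × ℕ) => t.1 ∈ q.1 ∧ t.2.1 = q.2 :=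
    (primrecPred_mem (fst.comp fst) (fst.comp snd)).and
      (Primrec.eq.comp (fst.comp (snd.comp fst)) (snd.comp snd))
  refine ((PrimrecRel.listFilter this).comp (fst.comp (snd.comp (fst.comp fst))) snd).of_eq
    fun q => ?_
  congr

theorem primrec_accepts : PrimrecRel Accepts :=
  primrecPred_exists_mem primrec_run
    (primrecPred_mem snd (snd.comp (snd.comp (fst.comp fst))))

theorem primrec_mem : PrimrecRel Mem := by
  refine primrecPred_exists_mem fst (.and ?_ ?_)
  · exact Primrec.eq.comp (fst.comp snd) (fst.comp (snd.comp fst))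
  · refine primrecPred_forall_lt (Primrec.list_length.comp (snd.comp (snd.comp fst))) ?_
    refine primrec_accepts.comp ?_ ?_
    · exact (Primrec.list_getD _).comp (snd.comp (snd.comp fst)) snd
    · exact (Primrec.list_getD _).comp (snd.comp (snd.comp (fst.comp fst))) snd

theorem primrec_perf : Primrec₂ perf := by
  refine (Primrec.option_casesOn (o := fun p : OpCode × List (List ℕ) => p.1)
    (f := fun p => [p.2]) (g := fun p o =>
      if o.1 = true then [p.2.set o.2.1 (p.2.getD o.2.1 [] ++ [o.2.2])]
      else if (p.2.getD o.2.1 []).head? = some o.2.2 then [p.2.set o.2.1 (p.2.getD o.2.1 []).tail]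
      else []) fst (Primrec.list_cons.comp snd (Primrec.const [])) ?_).of_eq fun p => by
      rcases p with ⟨_ | o, ws⟩ <;> rfl
  have hw : Primrec fun q : (OpCode × List (List ℕ)) × Bool × ℕ × ℕ => q.1.2 := snd.comp fst
  have hc : Primrec fun q : (OpCode × List (List ℕ)) × Bool × ℕ × ℕ => q.2.2.1 :=
    fst.comp (snd.comp snd)
  have hm : Primrec fun q : (OpCode × List (List ℕ)) × Bool × ℕ × ℕ => q.2.2.2 :=
    snd.comp (snd.comp snd)
  have hd := (Primrec.list_getD ([] : List ℕ)).comp hw hc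
  have hs : ∀ x : (OpCode × List (List ℕ)) × Bool × ℕ × ℕ → List ℕ, Primrec x →
      Primrec fun q : (OpCode × List (List ℕ)) × Bool × ℕ × ℕ => [q.1.2.set q.2.2.1 (x q)] := by
    intro x hx
    have h := Primrec.list_set.comp hw (Primrec.pair hc hx)
    exact Primrec.list_cons.comp h (Primrec.const [])
  refine Primrec.ite (Primrec.eq.comp (fst.comp snd) (Primrec.const true)) (hs _ ?_) ?_
  · exact Primrec.list_append.comp hd (Primrec.list_cons.comp hm (Primrec.const []))
  · exact Primrec.ite (Primrec.eq.comp (Primrec.list_head?.comp hd) (Primrec.option_some.comp hm))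
      (hs _ (Primrec.list_tail.comp hd)) (Primrec.const [])

theorem primrec_ruleSuccs : Primrec₂ ruleSuccs := by
  classical
  have hr : Primrec fun p : RuleCode × ConfCode => p.1.2.1 := fst.comp (snd.comp fst)
  have ho : Primrec fun p : RuleCode × ConfCode => p.1.2.2.1 :=
    fst.comp (snd.comp (snd.comp fst))
  refine Primrec.ite (.and ?_ ?_) ?_ (Primrec.const [])
  · exact Primrec.eq.comp (fst.comp fst) (fst.comp snd)
  · exact primrec_mem.comp hr snd
  · refine Primrec.list_flatMap (primrec_perf.comp ho (snd.comp snd)) ?_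
    refine Primrec.list_map (primrec_sections.comp (Primrec.list_map snd
      (primrec_sublists'.comp snd))) ?_
    exact Primrec.pair (snd.comp (snd.comp (snd.comp (fst.comp (fst.comp fst))))) snd

theorem primrec_succs : Primrec₂ succs :=
  Primrec.list_flatMap (snd.comp (snd.comp fst))
    (primrec_ruleSuccs.comp snd (snd.comp fst))

theorem primrec_owns (P : Player) : PrimrecRel (Owns P) :=
  primrecPred_iff (primrecPred_mem (fst.comp snd) (fst.comp (snd.comp fst))) (primrecPred_const _)

section Param

variable {α : Type*} [Primcodable α] {g : α → GameCode} (hg : Primrec g) (P : Player)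

include hg

theorem primrec_cPre {X : α → ConfCode → Prop}
    (hX : PrimrecPred fun p : α × ConfCode => X p.1 p.2) :
    PrimrecPred fun p : α × ConfCode => CPre P (g p.1) (X p.1) p.2 := by
  have hs : Primrec fun p : α × ConfCode => succs (g p.1) p.2 :=
    primrec_succs.comp (hg.comp fst) snd
  have ho : PrimrecPred fun p : α × ConfCode => Owns P (g p.1) p.2 :=
    (primrec_owns P).comp (hg.comp fst) snd
  have hX' : PrimrecPred fun q : (α × ConfCode) × ConfCode => X q.1.1 q.2 :=
    hX.comp (Primrec.pair (fst.comp fst) snd)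
  exact (ho.and (primrecPred_exists_mem hs hX')).or (ho.not.and (primrecPred_forall_mem hs hX'))

theorem primrec_stepOp (buchi : Bool) {V Y X : α → ConfCode → Prop}
    (hV : PrimrecPred fun p : α × ConfCode => V p.1 p.2)
    (hY : PrimrecPred fun p : α × ConfCode => Y p.1 p.2)
    (hX : PrimrecPred fun p : α × ConfCode => X p.1 p.2) :
    PrimrecPred fun p : α × ConfCode => StepOp P buchi (g p.1) (V p.1) (Y p.1) (X p.1) p.2 := by
  have ho : PrimrecPred fun p : α × ConfCode => Owns P (g p.1) p.2 :=
    (primrec_owns P).comp (hg.comp fst) snd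
  have hY1 := primrec_cPre hg P hY
  have hY2 := primrec_cPre (X := fun a => CPre P (g a) (Y a)) hg P hY1
  exact (hV.and (primrecPred_imp (primrecPred_const _)
    ((ho.and hY2).or (ho.not.and hY1)))).or (primrec_cPre hg P hX)

omit hg in
theorem primrec_fMem (f : Bool) {R : α → RegionCode} (hR : Primrec R) :
    PrimrecPred fun p : α × ConfCode => FMem f (R p.1) p.2 :=
  primrecPred_iff (primrec_mem.comp (hR.comp fst) snd)
    (primrecPred_const _)

end Param

theorem primrec_X : Primrec₂ CertCode.X :=
  (Primrec.list_getD _).comp (fst.comp (fst.comp fst)) snd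

theorem primrec_Y : Primrec₂ CertCode.Y :=
  (Primrec.list_getD _).comp (snd.comp (fst.comp fst)) snd

theorem primrec_checkAt {α : Type*} [Primcodable α] {g : α → GameCode} {v : α → RegionCode}
    {c : α → CertCode} (hg : Primrec g) (hv : Primrec v) (hc : Primrec c) (P : Player)
    (buchi f : Bool) :
    PrimrecPred fun p : α × ConfCode => CheckAt P buchi f (g p.1) (v p.1) (c p.1) p.2 := by
  have hn : Primrec fun a => (c a).2.1 := fst.comp (snd.comp hc)
  have hk : Primrec fun a => (c a).2.2 := snd.comp (snd.comp hc)
  have hX : ∀ {β : Type _} [Primcodable β] {d : β → CertCode} {i : β → ℕ}, Primrec d → Primrec i →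
      PrimrecPred fun p : β × ConfCode => FMem f ((d p.1).X (i p.1)) p.2 := fun hd hi =>
    primrec_fMem f (primrec_X.comp hd hi)
  have hY : ∀ {β : Type _} [Primcodable β] {d : β → CertCode} {i : β → ℕ}, Primrec d → Primrec i →
      PrimrecPred fun p : β × ConfCode => FMem f ((d p.1).Y (i p.1)) p.2 := fun hd hi =>
    primrec_fMem f (primrec_Y.comp hd hi)
  have hc1 : Primrec fun a : α × ℕ => c a.1 := hc.comp fst
  have hg1 : Primrec fun a : α × ℕ => g a.1 := hg.comp fst
  have hs : Primrec fun a : α × ℕ => a.2 + 1 := Primrec.succ.comp snd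
  have hV : PrimrecPred fun p : (α × ℕ) × ConfCode => FMem f (v p.1.1) p.2 :=
    primrec_fMem f (R := fun a : α × ℕ => v a.1) (hv.comp fst)
  have h1 : PrimrecPred fun p : (α × ℕ) × ConfCode => StepOp P buchi (g p.1.1)
      (FMem f (v p.1.1)) (FMem f ((c p.1.1).Y (c p.1.1).2.2)) (FMem f ((c p.1.1).X p.1.2)) p.2 :=
    primrec_stepOp (g := fun a : α × ℕ => g a.1)
      (V := fun a => FMem f (v a.1)) (Y := fun a => FMem f ((c a.1).Y (c a.1).2.2))
      (X := fun a => FMem f ((c a.1).X a.2)) hg1 P buchi hV (hY hc1 (hk.comp fst)) (hX hc1 snd)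
  have h2 : PrimrecPred fun p : (α × ℕ) × ConfCode => StepOp P buchi (g p.1.1)
      (FMem f (v p.1.1)) (FMem f ((c p.1.1).Y p.1.2)) (FMem f ((c p.1.1).Y (p.1.2 + 1))) p.2 :=
    primrec_stepOp (g := fun a : α × ℕ => g a.1)
      (V := fun a => FMem f (v a.1)) (Y := fun a => FMem f ((c a.1).Y a.2))
      (X := fun a => FMem f ((c a.1).Y (a.2 + 1))) hg1 P buchi hV (hY hc1 snd) (hY hc1 hs)
  have h3 := primrecPred_imp (hX hc1 hs) h1
  have h4 := primrecPred_imp h2 (hY hc1 hs)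
  have hswap : Primrec fun q : (α × ConfCode) × ℕ => ((q.1.1, q.2), q.1.2) :=
    Primrec.pair (Primrec.pair (fst.comp fst) snd) (snd.comp fst)
  have h5 := primrecPred_forall_lt (R := fun (a : α × ConfCode) i => FMem f ((c a.1).X (i + 1)) a.2 →
    StepOp P buchi (g a.1) (FMem f (v a.1)) (FMem f ((c a.1).Y (c a.1).2.2))
      (FMem f ((c a.1).X i)) a.2) (hn.comp fst) (h3.comp hswap)
  have h6 := primrecPred_forall_lt (R := fun (a : α × ConfCode) j =>
    StepOp P buchi (g a.1) (FMem f (v a.1)) (FMem f ((c a.1).Y j)) (FMem f ((c a.1).Y (j + 1))) a.2 →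
      FMem f ((c a.1).Y (j + 1)) a.2) (hk.comp fst) (h4.comp hswap)
  exact ((hX hc (Primrec.const 0)).not.and h5).and
    ((primrecPred_imp (hY hc hk) (hX hc hn)).and ((hY hc (Primrec.const 0)).and h6))

theorem primrec_words : Primrec₂ words := by
  refine Primrec.list_flatMap (Primrec.list_range.comp snd) ?_
  exact primrec_sections.comp
    (primrec_replicate.comp (Primrec.pair snd (Primrec.list_range.comp (fst.comp fst))))

theorem primrec_confs : Primrec₂ confs := by
  have hC : Primrec fun p : GameCode × ℕ => p.1.1.2.1 := fst.comp (snd.comp (fst.comp fst))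
  have hM : Primrec fun p : GameCode × ℕ => p.1.1.2.2 := snd.comp (snd.comp (fst.comp fst))
  have hw : Primrec fun p : GameCode × ℕ => words p.1.1.2.2 p.2 := primrec_words.comp hM snd
  have hr : Primrec fun p : GameCode × ℕ => List.replicate p.1.1.2.1 (words p.1.1.2.2 p.2) :=
    primrec_replicate.comp (Primrec.pair hC hw)
  have hs := primrec_sections.comp hr
  refine Primrec.list_flatMap (Primrec.list_range.comp (fst.comp (fst.comp fst))) ?_
  exact Primrec.list_map (hs.comp fst) (Primrec.pair (snd.comp fst) snd)

theorem primrec_refineCard : Primrec₂ refineCard := by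
  have h : Primrec fun p : ℕ × ℕ => 2 ^ p.2 := primrec_pow.comp (Primrec.const 2) snd
  exact Primrec.nat_mul.comp snd (Primrec.nat_mul.comp h
    (Primrec.nat_mul.comp (Primrec.succ.comp fst) h))

theorem primrec_bound :
    Primrec fun a : GameCode × RegionCode × CertCode => bound a.1 a.2.1 a.2.2 := by
  have hm : Primrec fun a : GameCode × RegionCode × CertCode => a.1.1.2.2 :=
    snd.comp (snd.comp (fst.comp fst))
  have he : Primrec fun a : GameCode × RegionCode × CertCode => Encodable.encode a + 1 :=
    Primrec.succ.comp Primrec.encode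
  exact primrec_refineCard.comp hm (primrec_refineCard.comp hm
    (primrec_pow.comp (Primrec.const 2) (Primrec.nat_mul.comp he he)))

theorem primrec_check (P : Player) (buchi f : Bool) :
    PrimrecPred fun a : GameCode × RegionCode × CertCode => Check P buchi f a.1 a.2.1 a.2.2 :=
  primrecPred_forall_mem (primrec_confs.comp fst primrec_bound)
    (primrec_checkAt fst (fst.comp snd) (snd.comp snd) P buchi f)

/-! ### Codes of games -/

/-- The rule `r` only uses locations, channels and messages of `g`, and passes the turn. -/
def ValidRule (g : GameCode) (r : RuleCode) : Prop :=
  r.1 < g.1.1 ∧ r.2.2.2 < g.1.1 ∧ (r.1 ∈ g.2.1 ↔ r.2.2.2 ∉ g.2.1) ∧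
    ∀ o ∈ r.2.2.1.toList, o.2.1 < g.1.2.1 ∧ o.2.2 < g.1.2.2

/-- `g` is the code of a game. -/
def Valid (g : GameCode) : Prop := ∀ r ∈ g.2.2, ValidRule g r

theorem primrec_valid : PrimrecPred Valid := by
  refine primrecPred_forall_mem (snd.comp snd) ?_
  have hr : Primrec fun p : GameCode × RuleCode => p.2.1 := fst.comp snd
  have ht : Primrec fun p : GameCode × RuleCode => p.2.2.2.2 :=
    snd.comp (snd.comp (snd.comp snd))
  have hn : Primrec fun p : GameCode × RuleCode => p.1.1.1 := fst.comp (fst.comp fst)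
  have hA : Primrec fun p : GameCode × RuleCode => p.1.2.1 := fst.comp (snd.comp fst)
  refine .and (Primrec.nat_lt.comp hr hn) (.and (Primrec.nat_lt.comp ht hn) (.and ?_ ?_))
  · exact primrecPred_iff (primrecPred_mem hr hA) (primrecPred_mem ht hA).not
  · refine primrecPred_forall_mem (Primrec.optionToList.comp (fst.comp (snd.comp (snd.comp snd)))) ?_
    refine .and (Primrec.nat_lt.comp ?_ ?_) (Primrec.nat_lt.comp ?_ ?_)
    · exact fst.comp (snd.comp snd)
    · exact fst.comp (snd.comp (fst.comp (fst.comp fst)))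
    · exact snd.comp (snd.comp snd)
    · exact snd.comp (snd.comp (fst.comp (fst.comp fst)))

theorem valid_of_encodes {Q C M : Type*} {num : Numbering Q C M} {g : GameCode}
    {L : SymGame Q C M} (hg : GameCode.Encodes num g L) : Valid g := by
  intro r hr
  obtain ⟨δ, hδ, h1, -, h2, h3⟩ := hg.2.2.1 r hr
  have hn : g.1 = (num.nQ, num.nC, num.nM) := hg.1
  rw [ValidRule, hn, h1, h2, h3]
  refine ⟨(num.loc _).2, (num.loc _).2, ?_, ?_⟩
  · rw [hg.2.1, hg.2.1, L.alternating δ hδ]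
    cases L.owner δ.tgt <;> simp
  · cases δ.op <;> simp [opCode]

theorem isRegion_denote {Q C M : Type} (num : Numbering Q C M) (R : RegionCode) :
    IsRegion (RegionCode.denote num R : Set (Conf Q C M)) := by
  have : Finite Q := Finite.of_equiv _ num.loc.symm
  have : Finite C := Finite.of_equiv _ num.chan.symm
  exact (respects_denote (Nat.lt_succ_self _)).isRegion (isRightCongruence_behaviour _)

/-- Needed for totality of the algorithm: a code that passes the syntactic test comes from an actual
game, so a certificate exists and the search ends. -/
theorem exists_encodes_of_valid {g : GameCode} (hg : Valid g) :
    ∃ (Q C M : Type) (num : Numbering Q C M) (L : SymGame Q C M), GameCode.Encodes num g L := by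
  classical
  let num : Numbering (Fin g.1.1) (Fin g.1.2.1) (Fin g.1.2.2) :=
    ⟨_, _, _, Equiv.refl _, Equiv.refl _, Equiv.refl _⟩
  have h : ∀ r ∈ g.2.2, ∃ δ : Rule (Fin g.1.1) (Fin g.1.2.1) (Fin g.1.2.2),
      RuleCode.Encodes num r δ := by
    intro r hr
    obtain ⟨h1, h2, -, h3⟩ := hg r hr
    have : ∃ op : Op (Fin g.1.2.1) (Fin g.1.2.2), r.2.2.1 = opCode num op := by
      generalize r.2.2.1 = o at h3
      match o, h3 with
      | none, _ => exact ⟨.internal, rfl⟩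
      | some (true, c, m), h3 =>
        obtain ⟨h4, h5⟩ := h3 (true, c, m) (by simp)
        exact ⟨.send ⟨c, h4⟩ ⟨m, h5⟩, rfl⟩
      | some (false, c, m), h3 =>
        obtain ⟨h4, h5⟩ := h3 (false, c, m) (by simp)
        exact ⟨.recv ⟨c, h4⟩ ⟨m, h5⟩, rfl⟩
    obtain ⟨op, hop⟩ := this
    exact ⟨⟨⟨r.1, h1⟩, RegionCode.denote num r.2.1, op, ⟨r.2.2.2, h2⟩⟩, rfl, rfl, hop, rfl⟩
  choose δ hδ using h
  refine ⟨_, _, _, num, ⟨⟨Set.range fun r : {r // r ∈ g.2.2} => δ r.1 r.2, Set.finite_range _, ?_⟩,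
    fun q => if (q : ℕ) ∈ g.2.1 then .A else .B, ?_⟩, rfl, ?_, ?_, ?_⟩
  · rintro _ ⟨⟨r, hr⟩, rfl⟩
    rw [← (hδ r hr).2.1]
    exact isRegion_denote num r.2.1
  · rintro _ ⟨⟨r, hr⟩, rfl⟩
    obtain ⟨-, -, h1, -⟩ := hg r hr
    obtain ⟨h2, -, -, h3⟩ := hδ r hr
    rw [h2, h3] at h1
    change (((δ r hr).src : ℕ) ∈ g.2.1 ↔ ((δ r hr).tgt : ℕ) ∉ g.2.1) at h1
    simp [h1]
  · intro q
    change (q : ℕ) ∈ g.2.1 ↔ (if (q : ℕ) ∈ g.2.1 then Player.A else Player.B) = Player.A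
    split_ifs with h <;> simp [h]
  · exact fun r hr => ⟨δ r hr, ⟨⟨r, hr⟩, rfl⟩, hδ r hr⟩
  · rintro _ ⟨⟨r, hr⟩, rfl⟩
    exact ⟨r, hr, hδ r hr⟩

/-! ### Codes of certificates -/

theorem exists_flagSet_eq {Q C M : Type} (num : Numbering Q C M) (f : Bool) {V : Set (Conf Q C M)}
    (hV : IsRegion V) : ∃ R : RegionCode, flagSet num f R = V := by
  have : Finite Q := Finite.of_equiv _ num.loc.symm
  have : Finite C := Finite.of_equiv _ num.chan.symm
  cases f with
  | true =>
    obtain ⟨R, rfl⟩ := exists_regionCode num hV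
    exact ⟨R, by simp [flagSet]⟩
  | false =>
    obtain ⟨R, hR⟩ := exists_regionCode num hV.compl
    exact ⟨R, by ext; simp [flagSet, hR]⟩

theorem isRegion_flagSet {Q C M : Type} (num : Numbering Q C M) (f : Bool) (R : RegionCode) :
    IsRegion (flagSet num f R : Set (Conf Q C M)) := by
  have : Finite Q := Finite.of_equiv _ num.loc.symm
  have : Finite C := Finite.of_equiv _ num.chan.symm
  exact (respects_flagSet f (Nat.lt_succ_self _)).isRegion (isRightCongruence_behaviour _)

theorem exists_check {Q C M : Type} {num : Numbering Q C M} {g : GameCode} {L : SymGame Q C M}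
    (hg : GameCode.Encodes num g L) (P : Player) (buchi f : Bool) (v : RegionCode) :
    ∃ c, Check P buchi f g v c := by
  have : Finite Q := Finite.of_equiv _ num.loc.symm
  have : Finite C := Finite.of_equiv _ num.chan.symm
  have : Finite M := Finite.of_equiv _ num.msg.symm
  obtain ⟨X, Y, n, k, h, hX, hY⟩ := L.exists_certifies P buchi (isRegion_flagSet num f v)
  choose x hx using fun i => exists_flagSet_eq num f (hX i)
  choose y hy using fun i => exists_flagSet_eq num f (hY i)
  -- The infinite sequences may be truncated, as the conditions mention only indices up to `n` and
  -- `k`.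
  refine ⟨(((List.range (n + 1)).map x, (List.range (k + 1)).map y), n, k),
    (check_iff hg _ _ _ _ _).2 ?_⟩
  have hx' : ∀ i ≤ n, flagSet num f (CertCode.X
      (((List.range (n + 1)).map x, (List.range (k + 1)).map y), n, k) i) = X i := fun i hi => by
    rw [← hx i, CertCode.X, List.getD_eq_getElem _ _ (by simpa using Nat.lt_succ_of_le hi)]
    simp
  have hy' : ∀ i ≤ k, flagSet num f (CertCode.Y
      (((List.range (n + 1)).map x, (List.range (k + 1)).map y), n, k) i) = Y i := fun i hi => by
    rw [← hy i, CertCode.Y, List.getD_eq_getElem _ _ (by simpa using Nat.lt_succ_of_le hi)]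
    simp
  refine ⟨?_, fun i hi => ?_, ?_, ?_, fun j hj => ?_⟩
  · rw [hx' 0 (Nat.zero_le _), h.X_zero]
  · rw [hx' _ hi, hx' _ (Nat.le_of_lt hi), hy' _ le_rfl]
    exact h.X_succ i hi
  · rw [hx' _ le_rfl, hy' _ le_rfl]
    exact h.subset_X
  · rw [hy' 0 (Nat.zero_le _), h.Y_zero]
  · rw [hy' _ hj, hy' _ (Nat.le_of_lt hj)]
    exact h.Y_succ j hj

/-! ### The algorithms -/

/-- The player whose goal of reachability or repeated reachability decides about `goal`. -/
def attacker : Goal → Player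
  | .reachability | .repeatedReachability => .A
  | .invariant | .persistence => .B

/-- Whether `goal` is about repeated reachability. -/
def isBuchi : Goal → Bool
  | .reachability | .invariant => false
  | .persistence | .repeatedReachability => true

/-- Whether `goal` is decided without passing to the opponent and to complements. -/
def isDirect : Goal → Bool
  | .reachability | .repeatedReachability => true
  | .invariant | .persistence => false

/-- For invariant and persistence goals the certificate concerns `B` and the complement of `V`. The
flag `false` makes every code stand for a complement, so `v` can be used as given and the last `Y`
denotes the winning set of `A` directly. -/
theorem winningSet_eq_of_check {Q C M : Type} {num : Numbering Q C M} {g : GameCode}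
    {L : SymGame Q C M} (hg : GameCode.Encodes num g L) (goal : Goal) {v : RegionCode}
    {c : CertCode} (hc : Check (attacker goal) (isBuchi goal) (isDirect goal) g v c) :
    L.winningSet .A goal (RegionCode.denote num v) = RegionCode.denote num (c.Y c.2.2) := by
  have h := ((check_iff hg _ _ _ _ _).1 hc).winningSet_eq
  have h1 : ∀ R : RegionCode, (flagSet num true R : Set (Conf Q C M)) = RegionCode.denote num R :=
    fun R => by ext; simp [flagSet]
  have h2 : ∀ R : RegionCode, (flagSet num false R : Set (Conf Q C M))ᶜ = RegionCode.denote num R :=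
    fun R => by ext; simp [flagSet]
  cases goal <;> simp only [attacker, isBuchi, isDirect, h1, h2] at h
  exacts [h.1, h.2, h.2, h.1]

theorem exists_computable_winningSet (goal : Goal) :
    ∃ F : GameCode × RegionCode → RegionCode, Computable F ∧
      ∀ (Q C M : Type) (num : Numbering Q C M) (L : SymGame Q C M) (g : GameCode)
        (v : RegionCode), GameCode.Encodes num g L →
        RegionCode.denote num (F (g, v)) = L.winningSet .A goal (RegionCode.denote num v) := by
  classical
  let t (a : GameCode × RegionCode) (c : CertCode) : Option RegionCode :=
    -- Inputs that are not codes of games accept any certificate, so that the search halts on them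
    -- as well.
    if ¬ Valid a.1 ∨ Check (attacker goal) (isBuchi goal) (isDirect goal) a.1 a.2 c then
      some (c.Y c.2.2) else none
  let f (a : GameCode × RegionCode) (n : ℕ) : Option RegionCode :=
    (Encodable.decode (α := CertCode) n).bind (t a)
  have ht : Primrec₂ t := by
    refine Primrec.ite (.or ?_ ?_) ?_ (Primrec.const none)
    · exact (primrec_valid.comp (fst.comp fst)).not
    · exact (primrec_check (attacker goal) (isBuchi goal) (isDirect goal)).comp
        (Primrec.pair (fst.comp fst) (Primrec.pair (snd.comp fst) snd))
    · exact Primrec.option_some.comp (primrec_Y.comp snd (snd.comp (snd.comp snd)))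
  have hf : Primrec₂ f :=
    Primrec.option_bind (Primrec.decode.comp snd) (ht.comp (fst.comp fst) snd)
  have hdom : ∀ a, (Nat.rfindOpt (f a)).Dom := by
    intro a
    have : ∃ c, ¬ Valid a.1 ∨ Check (attacker goal) (isBuchi goal) (isDirect goal) a.1 a.2 c := by
      by_cases hv : Valid a.1
      · obtain ⟨Q, C, M, num, L, hg⟩ := exists_encodes_of_valid hv
        obtain ⟨c, hc⟩ := exists_check hg (attacker goal) (isBuchi goal) (isDirect goal) a.2
        exact ⟨c, .inr hc⟩
      · exact ⟨(([], []), 0, 0), .inl hv⟩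
    obtain ⟨c, hc⟩ := this
    exact Nat.rfindOpt_dom.2 ⟨Encodable.encode c, c.Y c.2.2, by
      rw [Option.mem_def, show f a (Encodable.encode c) = t a c by
        simp only [f, Encodable.encodek, Option.bind_some]]
      exact if_pos hc⟩
  refine ⟨fun a => (Nat.rfindOpt (f a)).get (hdom a), ?_, ?_⟩
  · exact (Partrec.rfindOpt hf.to_comp).of_eq fun a => (Part.some_get (hdom a)).symm
  · intro Q C M num L g v hg
    obtain ⟨n, hn⟩ := Nat.rfindOpt_spec (Part.get_mem (hdom (g, v)))
    obtain ⟨c, -, hc⟩ := Option.bind_eq_some_iff.1 hn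
    simp only [t, valid_of_encodes hg, not_true, false_or] at hc
    split_ifs at hc with h
    rw [winningSet_eq_of_check hg goal h, Option.some.inj hc]

end Code
end LCS

theorem mainTheorem7 :
    -- the four winning sets are regions
    (∀ (Q C M : Type) [Finite Q] [Finite C] [Finite M] (L : LCS.SymGame Q C M)
      (V : Set (LCS.Conf Q C M)), LCS.IsRegion V →
        ∀ goal : LCS.Goal, LCS.IsRegion (L.winningSet .A goal V)) ∧
    -- for each goal, one algorithm computes them from codes of the game and of `V`
    (∀ goal : LCS.Goal, ∃ F : LCS.GameCode × LCS.RegionCode → LCS.RegionCode, Computable F ∧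
      ∀ (Q C M : Type) (num : LCS.Numbering Q C M) (L : LCS.SymGame Q C M)
        (g : LCS.GameCode) (v : LCS.RegionCode), LCS.GameCode.Encodes num g L →
          LCS.RegionCode.denote num (F (g, v)) =
            L.winningSet .A goal (LCS.RegionCode.denote num v)) ∧
    -- for each goal, one algorithm decides from these codes and a configuration who wins
    (∀ goal : LCS.Goal,
      ∃ D : LCS.GameCode × LCS.RegionCode × LCS.ConfCode → Bool, Computable D ∧
        ∀ (Q C M : Type) (num : LCS.Numbering Q C M) (L : LCS.SymGame Q C M)
          (g : LCS.GameCode) (v : LCS.RegionCode) (σ : LCS.Conf Q C M),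
          LCS.GameCode.Encodes num g L →
            (D (g, v, LCS.confCode num σ) = true ↔
              σ ∈ L.winningSet .A goal (LCS.RegionCode.denote num v))) := by
  refine ⟨?_, LCS.Code.exists_computable_winningSet, fun goal => ?_⟩
  · intro Q C M _ _ _ L V hV goal
    let num : LCS.Numbering Q C M :=
      ⟨_, _, _, Finite.equivFin Q, Finite.equivFin C, Finite.equivFin M⟩
    obtain ⟨g, hg⟩ := LCS.exists_gameCode num L
    obtain ⟨v, rfl⟩ := LCS.exists_regionCode num hV
    -- Regularity follows from the algorithm: its output is a region code for the winning set.
    obtain ⟨F, -, hF⟩ := LCS.Code.exists_computable_winningSet goal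
    rw [← hF Q C M num L g v hg]
    exact LCS.Code.isRegion_denote num _
  · classical
    obtain ⟨F, hF, hF'⟩ := LCS.Code.exists_computable_winningSet goal
    -- The decision procedure computes the winning region and runs its automata on the given
    -- configuration.
    refine ⟨fun a => decide (LCS.Code.Mem (F (a.1, a.2.1)) a.2.2), ?_, ?_⟩
    · exact LCS.Code.primrec_mem.decide.to_comp.comp
        (hF.comp (Computable.pair Computable.fst (Computable.fst.comp Computable.snd)))
        (Computable.snd.comp Computable.snd)
    · intro Q C M num L g v σ hg
      rw [decide_eq_true_iff, LCS.Code.mem_iff, hF' Q C M num L g v hg]
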